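/- Let $A$ be a separable purely infinite simple C$^*$-algebra, not necessarily unital; that is, $A\neq 0$ has no closed two-sided ideals other than $0$ and $A$, and every nonzero hereditary C$^*$-subalgebra of $A$ contains an infinite projection (a projection that is Murray–von Neumann equivalent in $A$ to a proper subprojection of itself). Let $\mathcal{M}(A)$ be the multiplier algebra of $A$ and $1$ its unit. Let $\mathbb{F}_\infty$ be the free group on countably infinitely many canonical generators, and let $\alpha\colon \mathbb{F}_\infty\to\mathrm{Aut}(A)$ be an action by $*$-automorphisms whose induced action on $\mathrm{K}_0(A)$ is trivial. For $x_1,x_2\in \mathrm{K}_0(A)$ let \[ \mathrm{P}(A;x_1,x_2)=\{(p_1,p_2): p_1,p_2\in A \text{ nonzero projections},\ [p_1]_0=x_1,\ [p_2]_0=x_2,\ p_1p_2=0,\ p_1+p_2\neq 1\} \] (possibly empty), with the metric given by the C$^*$-norm of $A\oplus A$. Then there is an inner perturbation $\beta\colon\mathbb{F}_\infty\to\mathrm{Aut}(A)$ of $\alpha$, that is, an action such that for every $s\in\mathbb{F}_\infty$ there is a unitary $u\in\mathcal{M}(A)$ with $\beta_s\circ\alpha_s^{-1}=\mathrm{Ad}(u)$,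 where $\mathrm{Ad}(u)(x)=uxu^*$, with the following properties. (1) The action of $\beta$ on $\mathrm{K}_0(A)$ is trivial, and for all $x_1,x_2\in\mathrm{K}_0(A)$ the induced action $s\cdot(p_1,p_2)=(\beta_s(p_1),\beta_s(p_2))$ of $\mathbb{F}_\infty$ on $\mathrm{P}(A;x_1,x_2)$ is minimal, that is, every orbit is dense in $\mathrm{P}(A;x_1,x_2)$. (2) The set of projections $p\in A$ for which $\beta_s(p)=p$ holds for at least two distinct canonical generators $s$ of $\mathbb{F}_\infty$ is norm-dense in the set of all projections of $A$. -/

import Mathlib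

open scoped Matrix MultiplierAlgebra

noncomputable section

namespace CStarPert

/-! ### The monoid `V(B)` of Murray–von Neumann classes of projections in matrices over `B` -/

section MonoidV

variable {B : Type*} [Ring B] [StarRing B]

/-- Projections in square matrices of arbitrary finite size over `B`. -/
structure ProjMat (B : Type*) [Ring B] [StarRing B] where
  size : ℕ
  mat : Matrix (Fin size) (Fin size) B
  isProj : IsStarProjection mat

/-- Murray–von Neumann equivalence of projection matrices, possibly of different sizes, through a
rectangular partial isometry. -/
def MvN {m n : Type*} [Fintype m] [Fintype n] (P : Matrix m m B) (Q : Matrix n n B) : Prop :=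
  ∃ v : Matrix m n B, v * vᴴ = P ∧ vᴴ * v = Q

namespace MvN

variable {k l m n : Type*} [Fintype k] [Fintype l] [Fintype m] [Fintype n]

theorem refl {P : Matrix m m B} (hP : IsStarProjection P) : MvN P P := by
  have h1 := hP.isIdempotentElem.eq
  have h2 : Pᴴ = P := hP.isSelfAdjoint.star_eq
  exact ⟨P, by rw [h2, h1], by rw [h2, h1]⟩

theorem symm {P : Matrix m m B} {Q : Matrix n n B} : MvN P Q → MvN Q P := by
  rintro ⟨v, h1, h2⟩
  exact ⟨vᴴ, by rw [Matrix.conjTranspose_conjTranspose, h2],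
    by rw [Matrix.conjTranspose_conjTranspose, h1]⟩

theorem trans {P : Matrix k k B} {Q : Matrix m m B} {R : Matrix n n B} (hP : IsStarProjection P)
    (hR : IsStarProjection R) : MvN P Q → MvN Q R → MvN P R := by
  rintro ⟨v, h1, h2⟩ ⟨w, h3, h4⟩
  refine ⟨v * w, ?_, ?_⟩
  · calc v * w * (v * w)ᴴ = v * (w * wᴴ) * vᴴ := by
          simp only [Matrix.conjTranspose_mul, Matrix.mul_assoc]
      _ = (v * vᴴ) * (v * vᴴ) := by rw [h3, ← h2]; simp only [Matrix.mul_assoc]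
      _ = P := by rw [h1, hP.isIdempotentElem.eq]
  · calc (v * w)ᴴ * (v * w) = wᴴ * (vᴴ * v) * w := by
          simp only [Matrix.conjTranspose_mul, Matrix.mul_assoc]
      _ = (wᴴ * w) * (wᴴ * w) := by rw [h2, ← h3]; simp only [Matrix.mul_assoc]
      _ = R := by rw [h4, hR.isIdempotentElem.eq]

theorem submatrix {P : Matrix m m B} (hP : IsStarProjection P) (e : n ≃ m) :
    MvN P (P.submatrix e e) := by
  have h1 := hP.isIdempotentElem.eq
  have h2 : Pᴴ = P := hP.isSelfAdjoint.star_eq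
  refine ⟨P.submatrix id e, ?_, ?_⟩
  · rw [Matrix.conjTranspose_submatrix, Matrix.submatrix_mul_equiv, h2, h1]
    rfl
  · rw [Matrix.conjTranspose_submatrix, h2]
    rw [← Matrix.submatrix_mul P P e id e Function.bijective_id, h1]

theorem blocks {P : Matrix k k B} {P' : Matrix l l B} {Q : Matrix m m B} {Q' : Matrix n n B} :
    MvN P P' → MvN Q Q' →
      MvN (Matrix.fromBlocks P 0 0 Q) (Matrix.fromBlocks P' 0 0 Q') := by
  rintro ⟨v, h1, h2⟩ ⟨w, h3, h4⟩
  refine ⟨Matrix.fromBlocks v 0 0 w, ?_, ?_⟩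
  · simp [Matrix.fromBlocks_conjTranspose, Matrix.fromBlocks_multiply, h1, h3]
  · simp [Matrix.fromBlocks_conjTranspose, Matrix.fromBlocks_multiply, h2, h4]

theorem blocks_zero {P : Matrix m m B} (hP : IsStarProjection P) :
    MvN (Matrix.fromBlocks P 0 0 (0 : Matrix n n B)) P := by
  have h1 := hP.isIdempotentElem.eq
  have h2 : Pᴴ = P := hP.isSelfAdjoint.star_eq
  refine ⟨Matrix.fromRows P 0, ?_, ?_⟩
  · simp only [Matrix.conjTranspose_fromRows_eq_fromCols_conjTranspose, h1, h2,
      Matrix.fromRows_mul_fromCols, Matrix.conjTranspose_zero, Matrix.mul_zero, Matrix.zero_mul]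
  · simp [Matrix.conjTranspose_fromRows_eq_fromCols_conjTranspose, Matrix.fromCols_mul_fromRows,
      h1, h2]

end MvN

theorem isStarProjection_blocks {m n : Type*} [Fintype m] [Fintype n] {P : Matrix m m B}
    {Q : Matrix n n B} (hP : IsStarProjection P) (hQ : IsStarProjection Q) :
    IsStarProjection (Matrix.fromBlocks P 0 0 Q) := by
  constructor
  · simp [IsIdempotentElem, Matrix.fromBlocks_multiply, hP.isIdempotentElem.eq,
      hQ.isIdempotentElem.eq]
  · have h1 : Pᴴ = P := hP.isSelfAdjoint.star_eq
    have h2 : Qᴴ = Q := hQ.isSelfAdjoint.star_eq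
    simp [IsSelfAdjoint, Matrix.star_eq_conjTranspose, Matrix.fromBlocks_conjTranspose, h1, h2]

theorem isStarProjection_submatrix {m n : Type*} [Fintype m] [Fintype n] {P : Matrix m m B}
    (hP : IsStarProjection P) (e : n ≃ m) : IsStarProjection (P.submatrix e e) := by
  constructor
  · rw [IsIdempotentElem, Matrix.submatrix_mul_equiv, hP.isIdempotentElem.eq]
  · have h1 : Pᴴ = P := hP.isSelfAdjoint.star_eq
    rw [IsSelfAdjoint, Matrix.star_eq_conjTranspose, Matrix.conjTranspose_submatrix, h1]

namespace ProjMat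

/-- Murray–von Neumann equivalence in matrices of arbitrary size. -/
def Equivalent (p q : ProjMat B) : Prop := MvN p.mat q.mat

/-- The block diagonal projection `diag(p, q)`. -/
def sum (p q : ProjMat B) : ProjMat B where
  size := p.size + q.size
  mat := (Matrix.fromBlocks p.mat 0 0 q.mat).submatrix finSumFinEquiv.symm finSumFinEquiv.symm
  isProj := isStarProjection_submatrix (isStarProjection_blocks p.isProj q.isProj) _

/-- The empty (`0 × 0`) projection. -/
def empty : ProjMat B where
  size := 0
  mat := 0
  isProj := IsStarProjection.zero _

/-- A projection of `B` as a `1 × 1` matrix. -/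
def ofElem (p : B) (hp : IsStarProjection p) : ProjMat B where
  size := 1
  mat := Matrix.diagonal fun _ => p
  isProj := by
    constructor
    · simp [IsIdempotentElem, Matrix.diagonal_mul_diagonal, hp.isIdempotentElem.eq]
    · have h := hp.isSelfAdjoint.star_eq
      simp only [IsSelfAdjoint, Matrix.star_eq_conjTranspose, Matrix.diagonal_conjTranspose]
      congr 1
      funext i
      exact h

/-- Entrywise image of a projection under a unital `*`-homomorphism. -/
def map [Algebra ℂ B] {C : Type*} [Ring C] [StarRing C] [Algebra ℂ C] (φ : B →⋆ₐ[ℂ] C)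
    (p : ProjMat B) : ProjMat C where
  size := p.size
  mat := p.mat.map φ
  isProj := by
    have hp := p.isProj.isIdempotentElem.eq
    have hp' : p.matᴴ = p.mat := p.isProj.isSelfAdjoint.star_eq
    constructor
    · rw [IsIdempotentElem, ← Matrix.map_mul, hp]
    · rw [IsSelfAdjoint, Matrix.star_eq_conjTranspose,
        ← Matrix.conjTranspose_map _ (fun x => map_star φ x), hp']

theorem sum_mvn (p q : ProjMat B) : MvN (p.sum q).mat (Matrix.fromBlocks p.mat 0 0 q.mat) :=
  (MvN.submatrix (isStarProjection_blocks p.isProj q.isProj) _).symm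

theorem Equivalent.sum {p p' q q' : ProjMat B} (h : Equivalent p p') (h' : Equivalent q q') :
    Equivalent (p.sum q) (p'.sum q') :=
  MvN.trans (p.sum q).isProj (p'.sum q').isProj
    (MvN.trans (p.sum q).isProj (isStarProjection_blocks p'.isProj q'.isProj) (sum_mvn p q)
      (MvN.blocks h h')) (sum_mvn p' q').symm

theorem Equivalent.map [Algebra ℂ B] {C : Type*} [Ring C] [StarRing C] [Algebra ℂ C]
    (φ : B →⋆ₐ[ℂ] C) {p q : ProjMat B} :
    Equivalent p q → Equivalent (p.map φ) (q.map φ) := by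
  rintro ⟨v, h1, h2⟩
  refine ⟨v.map φ, ?_, ?_⟩
  · change v.map φ * (v.map φ)ᴴ = p.mat.map φ
    rw [← Matrix.conjTranspose_map _ (fun x => map_star φ x), ← Matrix.map_mul, h1]
  · change (v.map φ)ᴴ * v.map φ = q.mat.map φ
    rw [← Matrix.conjTranspose_map _ (fun x => map_star φ x), ← Matrix.map_mul, h2]

theorem sum_comm (p q : ProjMat B) : Equivalent (p.sum q) (q.sum p) := by
  have h := MvN.submatrix (isStarProjection_blocks p.isProj q.isProj)
    (Equiv.sumComm (Fin q.size) (Fin p.size))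
  have e : (Matrix.fromBlocks p.mat 0 0 q.mat).submatrix
      (Equiv.sumComm (Fin q.size) (Fin p.size)) (Equiv.sumComm (Fin q.size) (Fin p.size)) =
      Matrix.fromBlocks q.mat 0 0 p.mat := by
    ext (i | i) (j | j) <;> rfl
  rw [e] at h
  exact MvN.trans (p.sum q).isProj (q.sum p).isProj
    (MvN.trans (p.sum q).isProj (isStarProjection_blocks q.isProj p.isProj) (sum_mvn p q) h)
    (sum_mvn q p).symm

theorem sum_assoc (p q r : ProjMat B) :
    Equivalent ((p.sum q).sum r) (p.sum (q.sum r)) := by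
  have hl := isStarProjection_blocks (isStarProjection_blocks p.isProj q.isProj) r.isProj
  have hr := isStarProjection_blocks p.isProj (isStarProjection_blocks q.isProj r.isProj)
  have h := MvN.submatrix hl (Equiv.sumAssoc (Fin p.size) (Fin q.size) (Fin r.size)).symm
  have e : (Matrix.fromBlocks (Matrix.fromBlocks p.mat 0 0 q.mat) 0 0 r.mat).submatrix
      (Equiv.sumAssoc (Fin p.size) (Fin q.size) (Fin r.size)).symm
      (Equiv.sumAssoc (Fin p.size) (Fin q.size) (Fin r.size)).symm =
      Matrix.fromBlocks p.mat 0 0 (Matrix.fromBlocks q.mat 0 0 r.mat) := by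
    ext (i | i | i) (j | j | j) <;> rfl
  rw [e] at h
  have h1 := MvN.trans ((p.sum q).sum r).isProj hl (sum_mvn (p.sum q) r)
    (MvN.blocks (sum_mvn p q) (MvN.refl r.isProj))
  have h2 := MvN.trans (p.sum (q.sum r)).isProj hr (sum_mvn p (q.sum r))
    (MvN.blocks (MvN.refl p.isProj) (sum_mvn q r))
  exact MvN.trans ((p.sum q).sum r).isProj (p.sum (q.sum r)).isProj
    (MvN.trans ((p.sum q).sum r).isProj hr h1 h) h2.symm

theorem sum_empty (p : ProjMat B) : Equivalent (p.sum empty) p :=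
  MvN.trans (p.sum empty).isProj p.isProj (sum_mvn p empty) (MvN.blocks_zero p.isProj)

end ProjMat

instance projSetoid (B : Type*) [Ring B] [StarRing B] : Setoid (ProjMat B) where
  r := ProjMat.Equivalent
  iseqv := ⟨fun p => MvN.refl p.isProj, MvN.symm, fun {p _ r} h h' => MvN.trans p.isProj r.isProj h h'⟩

/-- The set `V(B)` of Murray–von Neumann classes of projections in matrices over `B`. -/
def V (B : Type*) [Ring B] [StarRing B] : Type _ := Quotient (projSetoid B)

/-- The class of a projection in `V(B)`. -/
def V.mk (p : ProjMat B) : V B := Quotient.mk _ p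

instance (B : Type*) [Ring B] [StarRing B] : Zero (V B) := ⟨V.mk ProjMat.empty⟩

instance (B : Type*) [Ring B] [StarRing B] : Add (V B) :=
  ⟨Quotient.map₂ ProjMat.sum fun _ _ h _ _ h' => ProjMat.Equivalent.sum h h'⟩

/-- `V(B)` is a commutative monoid under the block diagonal sum. -/
instance (B : Type*) [Ring B] [StarRing B] : AddCommMonoid (V B) where
  add_assoc := by
    rintro ⟨p⟩ ⟨q⟩ ⟨r⟩
    exact Quotient.sound (ProjMat.sum_assoc p q r)
  add_comm := by
    rintro ⟨p⟩ ⟨q⟩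
    exact Quotient.sound (ProjMat.sum_comm p q)
  add_zero := by
    rintro ⟨p⟩
    exact Quotient.sound (ProjMat.sum_empty p)
  zero_add := by
    rintro ⟨p⟩
    exact (Quotient.sound (ProjMat.sum_comm _ p)).trans (Quotient.sound (ProjMat.sum_empty p))
  nsmul := nsmulRec

variable {C D : Type*} [Ring C] [StarRing C] [Ring D] [StarRing D]
  [Algebra ℂ B] [Algebra ℂ C] [Algebra ℂ D]

/-- The monoid homomorphism `V(B) → V(C)` induced by a unital `*`-homomorphism. -/
def V.map (φ : B →⋆ₐ[ℂ] C) : V B →+ V C where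
  toFun := Quotient.map (ProjMat.map φ) fun _ _ h => ProjMat.Equivalent.map φ h
  map_zero' := by
    refine congrArg V.mk ?_
    simp only [ProjMat.map, ProjMat.empty, ProjMat.mk.injEq, heq_eq_eq, true_and]
    ext i
    exact i.elim0
  map_add' := by
    rintro ⟨p⟩ ⟨q⟩
    refine congrArg V.mk ?_
    have h : (Matrix.fromBlocks p.mat 0 0 q.mat).map φ =
        Matrix.fromBlocks (p.mat.map φ) 0 0 (q.mat.map φ) := by
      rw [Matrix.fromBlocks_map, Matrix.map_zero _ (map_zero φ), Matrix.map_zero _ (map_zero φ)]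
    simp only [ProjMat.map, ProjMat.sum, ProjMat.mk.injEq, heq_eq_eq, true_and]
    exact congrArg (fun M => M.submatrix finSumFinEquiv.symm finSumFinEquiv.symm) h

/-- `K₀` of a unital algebra: the Grothendieck group of `V(B)`. -/
abbrev K0Unital (B : Type*) [Ring B] [StarRing B] : Type _ := Algebra.GrothendieckAddGroup (V B)

/-- The homomorphism of `K₀`-groups induced by a unital `*`-homomorphism. -/
def K0Unital.map (φ : B →⋆ₐ[ℂ] C) : K0Unital B →+ K0Unital C :=
  Algebra.GrothendieckAddGroup.lift (Algebra.GrothendieckAddGroup.of.comp (V.map φ))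

theorem K0Unital.map_of (φ : B →⋆ₐ[ℂ] C) (x : V B) :
    K0Unital.map φ (Algebra.GrothendieckAddGroup.of x) =
      Algebra.GrothendieckAddGroup.of (V.map φ x) :=
  DFunLike.congr_fun (Algebra.GrothendieckAddGroup.lift.symm_apply_apply
    (Algebra.GrothendieckAddGroup.of.comp (V.map φ))) x

theorem K0Unital.map_comp (ψ : C →⋆ₐ[ℂ] D) (φ : B →⋆ₐ[ℂ] C) (x : K0Unital B) :
    K0Unital.map ψ (K0Unital.map φ x) = K0Unital.map (ψ.comp φ) x := by
  suffices h : (K0Unital.map ψ).comp (K0Unital.map φ) = K0Unital.map (ψ.comp φ) from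
    DFunLike.congr_fun h x
  apply Algebra.GrothendieckAddGroup.lift.symm.injective
  ext y
  change K0Unital.map ψ (K0Unital.map φ (Algebra.GrothendieckAddGroup.of y)) =
    K0Unital.map (ψ.comp φ) (Algebra.GrothendieckAddGroup.of y)
  rw [K0Unital.map_of, K0Unital.map_of, K0Unital.map_of]
  congr 1
  obtain ⟨p⟩ := y
  rfl

end MonoidV

/-! ### `K₀` of a possibly non-unital C⋆-algebra -/

section K0

variable {A A' : Type*} [NonUnitalCStarAlgebra A] [NonUnitalCStarAlgebra A']

/-- The canonical character `A⁺ → ℂ` of the unitization. -/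
def unitizationChar (A : Type*) [NonUnitalCStarAlgebra A] : Unitization ℂ A →⋆ₐ[ℂ] ℂ where
  __ := Unitization.fstHom ℂ A
  map_star' _ := rfl

theorem unitizationChar_apply (x : Unitization ℂ A) : unitizationChar A x = x.fst := rfl

/-- `K₀(A)`, the kernel of the map `K₀(A⁺) → K₀(ℂ)`, where `A⁺` is the unitization of `A`. -/
def K0 (A : Type*) [NonUnitalCStarAlgebra A] : AddSubgroup (K0Unital (Unitization ℂ A)) :=
  (K0Unital.map (unitizationChar A)).ker

/-- The class `[p]₀ ∈ K₀(A)` of a projection `p` of `A`. -/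
def K0.cls (p : A) (hp : IsStarProjection p) : K0 A :=
  ⟨Algebra.GrothendieckAddGroup.of (V.mk (ProjMat.ofElem (p : Unitization ℂ A) hp.inr)), by
    have h : V.map (unitizationChar A) (V.mk (ProjMat.ofElem (p : Unitization ℂ A) hp.inr)) = 0 := by
      refine Quotient.sound (s := projSetoid ℂ) ⟨0, ?_, ?_⟩
      · refine (Matrix.zero_mul _).trans ?_
        ext i j
        fin_cases i
        fin_cases j
        simp [ProjMat.map, ProjMat.ofElem, unitizationChar_apply]
      · ext i
        exact i.elim0
    change K0Unital.map _ _ = 0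
    rw [K0Unital.map_of, h, map_zero]⟩

/-- The homomorphism `K₀(A) → K₀(A')` induced by a `*`-homomorphism. -/
def K0.map (φ : A →⋆ₙₐ[ℂ] A') : K0 A →+ K0 A' :=
  ((K0Unital.map (Unitization.starMap φ)).comp (K0 A).subtype).codRestrict (K0 A') (by
    rintro ⟨x, hx⟩
    have h : (unitizationChar A').comp (Unitization.starMap φ) = unitizationChar A := by
      ext a
      simp [unitizationChar_apply]
    change K0Unital.map _ (K0Unital.map _ x) = 0
    rw [K0Unital.map_comp, h]
    exact hx)

theorem K0.map_cls (φ : A →⋆ₙₐ[ℂ] A') (p : A) (hp : IsStarProjection p) :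
    K0.map φ (K0.cls p hp) = K0.cls (φ p) (hp.map φ) := by
  apply Subtype.ext
  change K0Unital.map (Unitization.starMap φ) (Algebra.GrothendieckAddGroup.of
    (V.mk (ProjMat.ofElem (p : Unitization ℂ A) hp.inr))) = _
  rw [K0Unital.map_of]
  refine congrArg (fun x => Algebra.GrothendieckAddGroup.of (V.mk x)) ?_
  simp only [ProjMat.map, ProjMat.ofElem, ProjMat.mk.injEq, heq_eq_eq, true_and]
  rw [Matrix.diagonal_map (map_zero _)]
  simp

end K0

/-! ### Purely infinite simple C⋆-algebras -/

section PurelyInfinite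

/-- `A` is simple: it is nonzero and has no closed two-sided ideals besides `0` and `A`. -/
def IsSimpleCStar (A : Type*) [NonUnitalCStarAlgebra A] : Prop :=
  Nontrivial A ∧ ∀ I : Submodule ℂ A, IsClosed (I : Set A) →
    (∀ a, ∀ x ∈ I, a * x ∈ I ∧ x * a ∈ I) → I = ⊥ ∨ I = ⊤

variable {A : Type*} [NonUnitalCStarAlgebra A]

/-- Positive elements of a C⋆-algebra. -/
def IsPos (a : A) : Prop := ∃ c : A, a = star c * c

/-- Hereditary C⋆-subalgebras: closed, and `0 ≤ a ≤ b ∈ H` implies `a ∈ H`. -/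
def IsHereditary (H : NonUnitalStarSubalgebra ℂ A) : Prop :=
  IsClosed (H : Set A) ∧ ∀ a b : A, b ∈ H → IsPos a → IsPos (b - a) → a ∈ H

/-- `p` is an infinite projection: it is equivalent to a proper subprojection of itself. -/
def IsInfiniteProj (p : A) : Prop :=
  IsStarProjection p ∧ ∃ v : A, star v * v = p ∧ p * (v * star v) = v * star v ∧ v * star v ≠ p

/-- `A` is simple and purely infinite: every nonzero hereditary C⋆-subalgebra contains an infinite
projection. -/
def IsPurelyInfiniteSimple (A : Type*) [NonUnitalCStarAlgebra A] : Prop :=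
  IsSimpleCStar A ∧ ∀ H : NonUnitalStarSubalgebra ℂ A, IsHereditary H → H ≠ ⊥ →
    ∃ p ∈ H, IsInfiniteProj p

end PurelyInfinite

/-! ### Actions, inner perturbations and the projection spaces -/

section Dynamics

variable {A : Type*} [NonUnitalCStarAlgebra A] {Γ : Type*} [Group Γ]

/-- `φ = Ad(u)` for a unitary `u` of the multiplier algebra. -/
def IsInner (φ : A ≃⋆ₐ[ℂ] A) : Prop :=
  ∃ u ∈ unitary 𝓜(ℂ, A), ∀ x : A, (φ x : 𝓜(ℂ, A)) = u * (x : 𝓜(ℂ, A)) * star u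

/-- `β` is an inner perturbation of `α`. -/
def IsInnerPerturbation (α β : Γ →* (A ≃⋆ₐ[ℂ] A)) : Prop :=
  ∀ s, IsInner (β s * (α s)⁻¹)

/-- The induced action on `K₀(A)` is trivial. -/
def ActsTriviallyOnK0 (α : Γ →* (A ≃⋆ₐ[ℂ] A)) : Prop :=
  ∀ s, K0.map (α s : A →⋆ₙₐ[ℂ] A) = AddMonoidHom.id (K0 A)

/-- The set `P(A; x₁, x₂) ⊆ A × A`. The product carries the maximum norm, which is the C⋆-norm of
`A ⊕ A`, and the unit `1` is that of the multiplier algebra. -/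
def projPairs (A : Type*) [NonUnitalCStarAlgebra A] (x₁ x₂ : K0 A) : Set (A × A) :=
  {p | p.1 ≠ 0 ∧ p.2 ≠ 0 ∧ (∃ h : IsStarProjection p.1, K0.cls p.1 h = x₁) ∧
    (∃ h : IsStarProjection p.2, K0.cls p.2 h = x₂) ∧ p.1 * p.2 = 0 ∧
    ((p.1 + p.2 : A) : 𝓜(ℂ, A)) ≠ 1}

theorem projPairs_mem_map (φ : A ≃⋆ₐ[ℂ] A)
    (hφ : K0.map (φ : A →⋆ₙₐ[ℂ] A) = AddMonoidHom.id (K0 A)) {x₁ x₂ : K0 A} {p : A × A}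
    (hp : p ∈ projPairs A x₁ x₂) : (φ p.1, φ p.2) ∈ projPairs A x₁ x₂ := by
  obtain ⟨h1, h2, ⟨h3, rfl⟩, ⟨h4, rfl⟩, h5, h6⟩ := hp
  have key : ∀ (q : A) (hq : IsStarProjection q),
      ∃ h : IsStarProjection (φ q), K0.cls (φ q) h = K0.cls q hq := fun q hq =>
    ⟨hq.map φ, (K0.map_cls (φ : A →⋆ₙₐ[ℂ] A) q hq).symm.trans (by rw [hφ]; rfl)⟩
  refine ⟨by simpa using h1, by simpa using h2, key _ h3, key _ h4, ?_, ?_⟩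
  · change φ p.1 * φ p.2 = 0
    rw [← map_mul, h5, map_zero]
  · intro h7
    apply h6
    have h8 : ∀ y : A, (p.1 + p.2) * y = y ∧ y * (p.1 + p.2) = y := by
      intro y
      have hl := congrArg (fun m : 𝓜(ℂ, A) => m.fst (φ y)) h7
      have hr := congrArg (fun m : 𝓜(ℂ, A) => m.snd (φ y)) h7
      simp at hl hr
      constructor
      · apply φ.injective
        change φ ((p.1 + p.2) * y) = φ y
        simpa [add_mul] using hl
      · apply φ.injective
        change φ (y * (p.1 + p.2)) = φ y
        simpa [mul_add] using hr
    ext y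
    · simpa [add_mul] using (h8 y).1
    · simpa [mul_add] using (h8 y).2

/-- The induced action `(p₁, p₂) ↦ (β_s(p₁), β_s(p₂))` on `P(A; x₁, x₂)` of an action `β` that is
trivial on `K₀(A)`. -/
@[reducible]
def projPairsAction (β : Γ →* (A ≃⋆ₐ[ℂ] A)) (hβ : ActsTriviallyOnK0 β) (x₁ x₂ : K0 A) :
    MulAction Γ (projPairs A x₁ x₂) where
  smul s p := ⟨(β s p.1.1, β s p.1.2), projPairs_mem_map (β s) (hβ s) p.2⟩
  one_smul p := by
    apply Subtype.ext
    change (β 1 p.1.1, β 1 p.1.2) = p.1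
    simp
  mul_smul s t p := by
    apply Subtype.ext
    change (β (s * t) p.1.1, β (s * t) p.1.2) = (β s (β t p.1.1), β s (β t p.1.2))
    simp

/-- The set of projections fixed by at least two distinct canonical generators. -/
def twoFixedProjections (β : FreeGroup ℕ →* (A ≃⋆ₐ[ℂ] A)) : Set A :=
  {p | IsStarProjection p ∧ ∃ i j : ℕ, i ≠ j ∧
    β (FreeGroup.of i) p = p ∧ β (FreeGroup.of j) p = p}

end Dynamics

end CStarPert

end

open scoped CStarAlgebra

noncomputable section

namespace CStarPert

/-! ### Equivalence and perturbation of projections -/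

/-! The generators of a free group can be perturbed independently, so each of them may be given one
job from a countable list. Choose a countable dense subset `D` of the union of all the spaces P(A;
x₁, x₂), and a countable dense set `E` of projections. The jobs are to carry `c` to `c'`, for `c`,
`c'` in `D` lying in a common space, and to fix `p` in `E`; each job of the second kind is listed
twice, so that two generators perform it. Automorphisms are isometric, so the jobs of the first kind
already make every orbit dense.

The generator `n` does its job through `Ad(u)` composed with `α` of that generator, where `u` is a
unitary of the unitization A⁺. Since `α` is trivial on K₀, such a `u` exists as soon as K₀ classes
determine pairs of projections up to a unitary. `exists_unitary_conj` adds three partial isometries,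
one for each projection and one for the complement 1 - p₁ - p₂. It is fed by two facts due in
essence to Cuntz: nonzero projections with equal class are equivalent (`ProjEquiv.of_cls_eq`), and
equivalent projections other than the unit of A have equivalent complements in A⁺
(`ProjEquiv.one_sub`).

Both facts come from comparison (`exists_factor`: any projection embeds below any nonzero one),
which yields cancellation (`ProjEquiv.of_vcls_add_eq`). As K₀ is built from matrices over A⁺, a
stable equivalence must also be moved into A: `exists_compression` does this approximately, with the
help of an approximate unit of projections (`exists_projection_near_unit`).

Finally the automorphisms `Ad(u)` form a normal subgroup acting trivially on K₀, so perturbing the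
generators perturbs every group element by some `Ad(w)`. -/

/-- Murray–von Neumann equivalence of elements. -/
def ProjEquiv {R : Type*} [Mul R] [Star R] (p q : R) : Prop :=
  ∃ v : R, v * star v = p ∧ star v * v = q

namespace ProjEquiv

variable {R : Type*} [NonUnitalRing R] [StarRing R] {p q r : R}

theorem refl (hp : IsStarProjection p) : ProjEquiv p p :=
  ⟨p, by rw [hp.isSelfAdjoint.star_eq, hp.isIdempotentElem.eq],
    by rw [hp.isSelfAdjoint.star_eq, hp.isIdempotentElem.eq]⟩

theorem symm : ProjEquiv p q → ProjEquiv q p := by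
  rintro ⟨v, h1, h2⟩
  exact ⟨star v, by rw [star_star, h2], by rw [star_star, h1]⟩

theorem trans (hp : IsStarProjection p) (hr : IsStarProjection r) :
    ProjEquiv p q → ProjEquiv q r → ProjEquiv p r := by
  rintro ⟨v, h1, h2⟩ ⟨w, h3, h4⟩
  refine ⟨v * w, ?_, ?_⟩
  · calc v * w * star (v * w) = v * (w * star w) * star v := by
          simp only [star_mul, mul_assoc]
      _ = (v * star v) * (v * star v) := by rw [h3, ← h2]; simp only [mul_assoc]
      _ = p := by rw [h1, hp.isIdempotentElem.eq]
  · calc star (v * w) * (v * w) = star w * (star v * v) * w := by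
          simp only [star_mul, mul_assoc]
      _ = (star w * w) * (star w * w) := by rw [h2, ← h3]; simp only [mul_assoc]
      _ = r := by rw [h4, hr.isIdempotentElem.eq]

end ProjEquiv

section NonUnital

variable {B : Type*} [NonUnitalCStarAlgebra B]

theorem eq_zero_of_star_mul_self {x : B} (h : star x * x = 0) : x = 0 :=
  CStarRing.star_mul_self_eq_zero_iff x |>.1 h

theorem eq_zero_of_mul_star_self {x : B} (h : x * star x = 0) : x = 0 :=
  CStarRing.mul_star_self_eq_zero_iff x |>.1 h

/-- If `v v⋆ = p` then `p v = v`. -/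
theorem mul_eq_of_mul_star_eq {p v : B} (hp : IsStarProjection p) (h : v * star v = p) :
    p * v = v := by
  rw [← sub_eq_zero]
  apply eq_zero_of_mul_star_self
  have h1 := hp.isIdempotentElem.eq
  rw [star_sub, star_mul, hp.isSelfAdjoint.star_eq]
  calc (p * v - v) * (star v * p - star v)
      = p * (v * star v) * p - p * (v * star v) - (v * star v) * p + v * star v := by
        simp only [mul_sub, sub_mul, mul_assoc]; abel
    _ = 0 := by rw [h, h1, h1]; abel

theorem mul_eq_of_star_mul_eq {q v : B} (hq : IsStarProjection q) (h : star v * v = q) :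
    v * q = v := by
  have := mul_eq_of_mul_star_eq hq (v := star v) (by rwa [star_star])
  simpa [hq.isSelfAdjoint.star_eq] using congrArg star this

/-- Orthogonal sums of equivalent projections are equivalent. -/
theorem ProjEquiv.add {p q p' q' : B} (hp : IsStarProjection p) (hq : IsStarProjection q)
    (hp' : IsStarProjection p') (hq' : IsStarProjection q') (hpp : p * p' = 0) (hqq : q * q' = 0) :
    ProjEquiv p q → ProjEquiv p' q' → ProjEquiv (p + p') (q + q') := by
  rintro ⟨v, h1, h2⟩ ⟨w, h3, h4⟩
  have a1 := mul_eq_of_mul_star_eq hp h1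
  have a2 := mul_eq_of_star_mul_eq hq h2
  have a3 := mul_eq_of_mul_star_eq hp' h3
  have a4 := mul_eq_of_star_mul_eq hq' h4
  have e1 : star v * w = 0 := by
    rw [← a1, ← a3, star_mul, hp.isSelfAdjoint.star_eq, mul_assoc, ← mul_assoc p, hpp]; simp
  have e2 : v * star w = 0 := by
    rw [← a2, ← a4, star_mul, hq'.isSelfAdjoint.star_eq, mul_assoc, ← mul_assoc q, hqq]; simp
  have e3 : star w * v = 0 := by simpa using congrArg star e1
  have e4 : w * star v = 0 := by simpa using congrArg star e2
  exact ⟨v + w, by simp [mul_add, add_mul, h1, h3, e2, e4],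
    by simp [mul_add, add_mul, h2, h4, e1, e3]⟩

end NonUnital

section CStar

variable {B : Type*} [CStarAlgebra B]

/-- An approximately isometric element between two corners yields an equivalence. -/
theorem ProjEquiv.of_corner {P Q y : B} (hP : IsStarProjection P) (hQ : IsStarProjection Q)
    (hPy : P * y = y) (hyQ : y * Q = y) (h1 : ‖star y * y - Q‖ < 1) (h2 : ‖y * star y - P‖ < 1) :
    ProjEquiv P Q := by
  let _ := CStarAlgebra.spectralOrder B
  have _ := CStarAlgebra.spectralOrderedRing B
  have hQs := hQ.isSelfAdjoint.star_eq
  have hPs := hP.isSelfAdjoint.star_eq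
  have hQQ := hQ.isIdempotentElem.eq
  have hPP := hP.isIdempotentElem.eq
  have hQy : Q * star y = star y := by simpa [hQs] using congrArg star hyQ
  have hyP : star y * P = star y := by simpa [hPs] using congrArg star hPy
  -- Adding the complementary projections makes `y⋆ y` and `y y⋆` invertible in the whole algebra,
  -- so that the polar decomposition of `y` is available.
  obtain ⟨g, hg⟩ : IsUnit (star y * y + (1 - Q)) := by
    have := isUnit_one_sub_of_norm_lt_one (x := Q - star y * y) (by rwa [norm_sub_rev])
    convert this using 1; abel
  obtain ⟨k, hk⟩ : IsUnit (y * star y + (1 - P)) := by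
    have := isUnit_one_sub_of_norm_lt_one (x := P - y * star y) (by rwa [norm_sub_rev])
    convert this using 1; abel
  have hgpos : 0 ≤ (g : B) := by
    rw [hg]
    refine add_nonneg (star_mul_self_nonneg y) ?_
    exact hQ.one_sub.nonneg
  have hgi : 0 ≤ (↑g⁻¹ : B) := by
    have h3 : star (↑g⁻¹ : B) = ↑g⁻¹ := by
      have h4 : star g = g := Units.ext (by simpa using hgpos.isSelfAdjoint.star_eq)
      rw [← Units.coe_star, star_inv, h4]
    have h5 := star_left_conjugate_nonneg hgpos (↑g⁻¹ : B)
    rwa [h3, Units.inv_mul, one_mul] at h5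
  set s := CFC.sqrt (↑g⁻¹ : B) with hs
  have hss : s * s = ↑g⁻¹ := CFC.sqrt_mul_sqrt_self _ hgi
  have hsa : star s = s := (CFC.sqrt_nonneg _).isSelfAdjoint.star_eq
  have hgQ : (g : B) * Q = star y * y := by
    rw [hg, add_mul, mul_assoc, hyQ, sub_mul, hQQ]; simp
  have hQg : Q * (g : B) = star y * y := by
    rw [hg, mul_add, ← mul_assoc, hQy, mul_sub, hQQ]; simp
  have cQ : Commute (↑g⁻¹ : B) Q := by
    have : Commute (g : B) Q := hgQ.trans hQg.symm
    exact this.units_inv_left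
  have csQ : Commute s Q := cQ.cfcₙ_nnreal _
  have csg : Commute s (g : B) := by
    have : Commute (↑g⁻¹ : B) (g : B) := by simp [Commute, SemiconjBy]
    exact this.cfcₙ_nnreal _
  -- This is the polar part of `y`. That its range projection is `P` is checked after multiplication
  -- by the invertible `k`.
  refine ⟨y * s, ?_, ?_⟩
  · have e : y * s * star (y * s) = y * ↑g⁻¹ * star y := by
      rw [star_mul, hsa, ← hss]; simp only [mul_assoc]
    have e1 : (↑g⁻¹ : B) * (star y * y) = Q := by rw [← hgQ, ← mul_assoc]; simp
    have e2 : (y * ↑g⁻¹ * star y) * (k : B) = P * (k : B) := by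
      rw [hk]
      calc (y * ↑g⁻¹ * star y) * (y * star y + (1 - P))
          = y * (↑g⁻¹ * (star y * y)) * star y + y * ↑g⁻¹ * (star y - star y * P) := by noncomm_ring
        _ = y * star y := by rw [e1, hyQ, hyP]; simp
        _ = P * (y * star y + (1 - P)) := by
            rw [mul_add, ← mul_assoc, hPy, mul_sub, hPP]; simp
    rw [e]
    exact k.isUnit.mul_left_injective e2
  · calc star (y * s) * (y * s) = s * (star y * y) * s := by
          rw [star_mul, hsa]; simp only [mul_assoc]
      _ = (s * s) * (g : B) * Q := by
          rw [← hgQ, mul_assoc, mul_assoc, ← csQ.eq, ← mul_assoc (g : B), ← csg.eq]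
          simp only [mul_assoc]
      _ = Q := by rw [hss]; simp

theorem ProjEquiv.of_norm_sub_lt_one {p q : B} (hp : IsStarProjection p) (hq : IsStarProjection q)
    (h : ‖p - q‖ < 1) : ProjEquiv p q := by
  have hp1 := hp.isIdempotentElem.eq
  have hq1 := hq.isIdempotentElem.eq
  have hp2 := hp.isSelfAdjoint.star_eq
  have hq2 := hq.isSelfAdjoint.star_eq
  have corner : ∀ r x : B, IsStarProjection r → ‖x‖ < 1 → ‖r * x * r‖ < 1 := by
    intro r x hr hx
    refine lt_of_le_of_lt ?_ hx
    calc ‖r * x * r‖ ≤ ‖r‖ * ‖x‖ * ‖r‖ := norm_mul₃_le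
      _ ≤ 1 * ‖x‖ * 1 := by gcongr <;> exact IsStarProjection.norm_le r hr
      _ = ‖x‖ := by ring
  refine ProjEquiv.of_corner (y := p * q) hp hq (by rw [← mul_assoc, hp1]) (by rw [mul_assoc, hq1])
    ?_ ?_
  · convert corner q (p - q) hq h using 2
    rw [star_mul, hp2, hq2, mul_sub, sub_mul, hq1, hq1, mul_assoc, ← mul_assoc p, hp1, mul_assoc]
  · convert corner p (q - p) hp (by rwa [norm_sub_rev]) using 2
    rw [star_mul, hp2, hq2, mul_sub, sub_mul, hp1, hp1, mul_assoc, ← mul_assoc q, hq1, mul_assoc]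

/-- An approximate partial isometry is cut down to the corners. The error splits into three terms of
norm at most 5/16, 5/16 and 1/4, with sum 7/8. -/
theorem norm_corner_sub_lt_one {P Q x : B} (hP : IsStarProjection P) (hQ : IsStarProjection Q)
    (h1 : ‖x * star x - P‖ ≤ 1 / 4) (h2 : ‖star x * x - Q‖ ≤ 1 / 4) :
    ‖star (P * x * Q) * (P * x * Q) - Q‖ < 1 := by
  have hQ1 := hQ.isIdempotentElem.eq
  have hQn := IsStarProjection.norm_le Q hQ
  have e : star (P * x * Q) * (P * x * Q) - Q =
      Q * (star x * (P - x * star x) * x + (star x * x - Q) * (star x * x) +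
        Q * (star x * x - Q)) * Q := by
    have h3 : Q * (star x * (P - x * star x) * x + (star x * x - Q) * (star x * x) +
        Q * (star x * x - Q)) * Q = Q * star x * P * x * Q - Q * Q * Q * Q := by noncomm_ring
    have h4 : star (P * x * Q) * (P * x * Q) = Q * star x * (P * P) * x * Q := by
      rw [star_mul, star_mul, hQ.isSelfAdjoint.star_eq, hP.isSelfAdjoint.star_eq]
      simp only [mul_assoc]
    rw [h3, h4, hP.isIdempotentElem.eq, hQ1, hQ1, hQ1]
  have hxx : ‖star x * x‖ ≤ 5 / 4 := by
    have := norm_le_norm_sub_add (star x * x) Q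
    linarith
  have hx2 : ‖x‖ * ‖x‖ ≤ 5 / 4 := by rwa [← CStarRing.norm_star_mul_self]
  have t1 : ‖star x * (P - x * star x) * x‖ ≤ 5 / 16 := by
    calc _ ≤ ‖star x‖ * ‖P - x * star x‖ * ‖x‖ := norm_mul₃_le
      _ ≤ ‖star x‖ * (1 / 4) * ‖x‖ := by rw [norm_sub_rev]; gcongr
      _ ≤ 5 / 16 := by rw [norm_star]; linarith
  have t2 : ‖(star x * x - Q) * (star x * x)‖ ≤ 5 / 16 := by
    calc _ ≤ ‖star x * x - Q‖ * ‖star x * x‖ := norm_mul_le _ _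
      _ ≤ (1 / 4) * (5 / 4) := by gcongr
      _ = 5 / 16 := by norm_num
  have t3 : ‖Q * (star x * x - Q)‖ ≤ 1 / 4 := by
    calc _ ≤ ‖Q‖ * ‖star x * x - Q‖ := norm_mul_le _ _
      _ ≤ 1 * (1 / 4) := by gcongr
      _ = 1 / 4 := by norm_num
  rw [e]
  calc _ ≤ ‖Q‖ * ‖star x * (P - x * star x) * x + (star x * x - Q) * (star x * x) +
        Q * (star x * x - Q)‖ * ‖Q‖ := norm_mul₃_le
    _ ≤ 1 * (5 / 16 + 5 / 16 + 1 / 4) * 1 := by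
        gcongr
        exact (norm_add₃_le).trans (by gcongr)
    _ < 1 := by norm_num

theorem ProjEquiv.of_approx {P Q x : B} (hP : IsStarProjection P) (hQ : IsStarProjection Q)
    (h1 : ‖x * star x - P‖ ≤ 1 / 4) (h2 : ‖star x * x - Q‖ ≤ 1 / 4) : ProjEquiv P Q := by
  have h3 := norm_corner_sub_lt_one hP hQ h1 h2
  have h4 := norm_corner_sub_lt_one (x := star x) hQ hP (by rwa [star_star]) (by rwa [star_star])
  refine ProjEquiv.of_corner hP hQ ?_ ?_ h3 ?_
  · simp only [← mul_assoc, hP.isIdempotentElem.eq]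
  · simp only [mul_assoc, hQ.isIdempotentElem.eq]
  · convert h4 using 3
    simp [hP.isSelfAdjoint.star_eq, hQ.isSelfAdjoint.star_eq, mul_assoc]

/-- The piecewise linear function with value `0` on `(-∞, 0]` and `1` on `[1, ∞)`. -/
def clamp (t : ℝ) : ℝ := max 0 (min t 1)

@[fun_prop]
theorem continuous_clamp : Continuous clamp := by unfold clamp; fun_prop

theorem clamp_of_nonpos {t : ℝ} (h : t ≤ 0) : clamp t = 0 := by
  unfold clamp; exact max_eq_left ((min_le_left _ _).trans h)

theorem clamp_of_one_le {t : ℝ} (h : 1 ≤ t) : clamp t = 1 := by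
  unfold clamp; rw [min_eq_right h]; exact max_eq_right zero_le_one

theorem clamp_nonneg (t : ℝ) : 0 ≤ clamp t := le_max_left _ _

theorem clamp_le_one (t : ℝ) : clamp t ≤ 1 := max_le zero_le_one (min_le_right _ _)

/-- A selfadjoint approximate idempotent is close to a projection. -/
theorem exists_projection_near {x : B} (hx : IsSelfAdjoint x) {δ : ℝ} (hδ : δ < 3 / 16)
    (h : ‖x * x - x‖ ≤ δ) : ∃ r : B, IsStarProjection r ∧ ‖r - x‖ ≤ 2 * δ ∧ ∃ y, r = x * y := by
  have hsp : ∀ t ∈ spectrum ℝ x, |t * t - t| ≤ δ := by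
    intro t ht
    have h1 : cfc (fun t : ℝ => t * t - t) x = x * x - x := by
      rw [cfc_sub (fun t => t * t) (fun t => t) x, cfc_mul (fun t => t) (fun t => t) x, cfc_id' ℝ x]
    have h2 := norm_apply_le_norm_cfc (fun t : ℝ => t * t - t) x ht
    rw [h1] at h2
    exact h2.trans h
  -- The bound 3/16 is the value of t - t² at 1/4 and at 3/4, so the spectrum avoids the interval
  -- between them.
  have key : ∀ t ∈ spectrum ℝ x, (t ≤ 1 / 4 ∧ |t| ≤ 2 * δ) ∨ (3 / 4 ≤ t ∧ |1 - t| ≤ 2 * δ) := by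
    intro t ht
    have h1 := abs_le.1 (hsp t ht)
    rcases le_total t (1 / 2) with h2 | h2
    · left
      refine ⟨by nlinarith, abs_le.2 ⟨?_, ?_⟩⟩
      · rcases le_total 0 t with h3 | h3 <;> nlinarith
      · rcases le_total 0 t with h3 | h3 <;> nlinarith
    · right
      refine ⟨by nlinarith, abs_le.2 ⟨?_, ?_⟩⟩
      · rcases le_total 1 t with h3 | h3 <;> nlinarith
      · rcases le_total 1 t with h3 | h3 <;> nlinarith
  set f : ℝ → ℝ := fun t => clamp (2 * t - 1 / 2) with hf
  have hf0 : ∀ t, t ≤ 1 / 4 → f t = 0 := fun t ht => clamp_of_nonpos (by linarith)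
  have hf1 : ∀ t, 3 / 4 ≤ t → f t = 1 := fun t ht => clamp_of_one_le (by linarith)
  have hfc : Continuous f := by fun_prop
  refine ⟨cfc f x, ⟨?_, cfc_predicate f x⟩, ?_, cfc (fun t => f t / max t (1 / 4)) x, ?_⟩
  · rw [IsIdempotentElem, ← cfc_mul f f x]
    refine cfc_congr fun t ht => ?_
    rcases key t ht with ⟨h1, _⟩ | ⟨h1, _⟩
    · simp [hf0 t h1]
    · simp [hf1 t h1]
  · have h1 : cfc f x - x = cfc (fun t => f t - t) x := by
      rw [cfc_sub f (fun t => t) x, cfc_id' ℝ x]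
    have hδ0 : 0 ≤ δ := (norm_nonneg _).trans h
    rw [h1]
    refine norm_cfc_le (by linarith) fun t ht => ?_
    rw [Real.norm_eq_abs]
    rcases key t ht with ⟨h1, h2⟩ | ⟨h1, h2⟩
    · simpa [hf0 t h1] using h2
    · simpa [hf1 t h1] using h2
  -- Since `f` vanishes up to 1/4, it is divisible by `t`. The resulting factorization through `x`
  -- passes membership in `A` and left annihilation relations from `x` to the projection.
  · have hc : Continuous fun t => f t / max t (1 / 4) := by
      refine hfc.div (by fun_prop) fun t => ?_
      have := le_max_right t (1 / 4); positivity
    have h1 : x * cfc (fun t => f t / max t (1 / 4)) x =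
        cfc (fun t => t * (f t / max t (1 / 4))) x := by
      rw [cfc_mul (fun t => t) (fun t => f t / max t (1 / 4)) x (by fun_prop) hc.continuousOn,
        cfc_id' ℝ x]
    rw [h1]
    refine cfc_congr fun t ht => ?_
    rcases le_total t (1 / 4) with h2 | h2
    · simp [hf0 t h2]
    · rw [max_eq_left h2]
      field_simp

end CStar

section PurelyInfinite

variable {A : Type*} [NonUnitalCStarAlgebra A]

/-! ### Projections and comparison in purely infinite simple algebras -/

theorem exists_inr_eq {A : Type*} [AddZeroClass A] {x : A⁺¹} (h : x.fst = 0) : ∃ a : A, (a : A⁺¹) = x :=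
  ⟨x.snd, Unitization.ext (by simp [h]) (by simp)⟩

/-- The elements of `A` annihilated on both sides by a selfadjoint `b`. -/
def annihilator (b : A⁺¹) (hb : IsSelfAdjoint b) : NonUnitalStarSubalgebra ℂ A where
  carrier := {x | b * (x : A⁺¹) = 0 ∧ (x : A⁺¹) * b = 0}
  add_mem' := by
    rintro x y ⟨h1, h2⟩ ⟨h3, h4⟩
    simp only [Set.mem_ofPred_eq, Unitization.inr_add]
    rw [mul_add, add_mul, h1, h2, h3, h4]; simp
  zero_mem' := by simp
  mul_mem' := by
    rintro x y ⟨h1, h2⟩ ⟨h3, h4⟩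
    simp only [Set.mem_ofPred_eq, Unitization.inr_mul]
    exact ⟨by rw [← mul_assoc, h1, zero_mul], by rw [mul_assoc, h4, mul_zero]⟩
  smul_mem' := by
    rintro c x ⟨h1, h2⟩
    simp only [Set.mem_ofPred_eq, Unitization.inr_smul]
    rw [mul_smul_comm, smul_mul_assoc, h1, h2]; simp
  star_mem' := by
    rintro x ⟨h1, h2⟩
    simp only [Set.mem_ofPred_eq, Unitization.inr_star]
    constructor
    · simpa [hb.star_eq] using congrArg star h2
    · simpa [hb.star_eq] using congrArg star h1

theorem mem_annihilator {b : A⁺¹} {hb : IsSelfAdjoint b} {x : A} :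
    x ∈ annihilator b hb ↔ b * (x : A⁺¹) = 0 ∧ (x : A⁺¹) * b = 0 := Iff.rfl

/-- If `d = c⋆ c + c'⋆ c'` is killed by `b`, then `b d b = 0` is a sum of two positive elements, so
both vanish and `c b = 0`. -/
theorem isHereditary_annihilator (b : A⁺¹) (hb : IsSelfAdjoint b) :
    IsHereditary (annihilator b hb) := by
  constructor
  · have hc : Continuous fun x : A => (x : A⁺¹) := Unitization.continuous_inr
    exact (isClosed_eq (continuous_const.mul hc) continuous_const).inter
      (isClosed_eq (hc.mul continuous_const) continuous_const)
  · rintro a d hd ⟨c, rfl⟩ ⟨c', hc'⟩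
    let _ := CStarAlgebra.spectralOrder A⁺¹
    have _ := CStarAlgebra.spectralOrderedRing A⁺¹
    have e : d = star c * c + star c' * c' := by rw [← hc']; abel
    have h1 : star ((c : A⁺¹) * b) * (c * b) + star ((c' : A⁺¹) * b) * (c' * b) = 0 := by
      have h2 := (mem_annihilator.1 hd).1
      rw [e] at h2
      calc _ = b * ((star c * c + star c' * c' : A) : A⁺¹) * b := by
            simp [hb.star_eq, mul_add, add_mul, mul_assoc]
        _ = 0 := by rw [h2, zero_mul]
    have h3 : (c : A⁺¹) * b = 0 := by
      apply eq_zero_of_star_mul_self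
      refine le_antisymm ?_ (star_mul_self_nonneg _)
      rw [← h1]
      exact le_add_of_nonneg_right (star_mul_self_nonneg _)
    have h4 : b * star (c : A⁺¹) = 0 := by simpa [hb.star_eq] using congrArg star h3
    rw [mem_annihilator, Unitization.inr_mul, Unitization.inr_star]
    exact ⟨by rw [← mul_assoc, h4, zero_mul], by rw [mul_assoc, h3, mul_zero]⟩

/-- The one place where pure infiniteness is invoked. With `b = 1 - p` it gives infinite projections
below `p`; with `b = k` or `b = e`, infinite projections orthogonal to a given element. -/
theorem exists_infinite_of_annihilated (hA : IsPurelyInfiniteSimple A) {b : A⁺¹}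
    (hb : IsSelfAdjoint b) {z : A} (hz : z ≠ 0) (h1 : b * (z : A⁺¹) = 0) (h2 : (z : A⁺¹) * b = 0) :
    ∃ p : A, IsInfiniteProj p ∧ b * (p : A⁺¹) = 0 := by
  obtain ⟨p, hp, hp'⟩ := hA.2 _ (isHereditary_annihilator b hb) (fun h => hz (by
    have h3 : z ∈ annihilator b hb := ⟨h1, h2⟩
    rw [h] at h3
    exact NonUnitalStarAlgebra.mem_bot.1 h3))
  exact ⟨p, hp', hp.1⟩

/-- Every nonzero projection dominates infinitely many orthogonal copies of a nonzero one. -/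
theorem exists_orthogonal_copies (hA : IsPurelyInfiniteSimple A) {p : A}
    (hp : IsStarProjection p) (hp0 : p ≠ 0) :
    ∃ f : A, IsStarProjection f ∧ f ≠ 0 ∧ ∃ t : ℕ → A,
      (∀ i j, star (t i) * t j = if i = j then f else 0) ∧ ∀ i, p * t i = t i := by
  obtain ⟨p₁, ⟨hp₁, v, hv1, hv2, hv3⟩, hpp⟩ := exists_infinite_of_annihilated hA
    (b := 1 - (p : A⁺¹)) (hp.inr.one_sub.isSelfAdjoint) hp0
    (by rw [sub_mul, ← Unitization.inr_mul, hp.isIdempotentElem.eq]; simp)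
    (by rw [mul_sub, ← Unitization.inr_mul, hp.isIdempotentElem.eq]; simp)
  have hpp' : p * p₁ = p₁ := by
    apply Unitization.inr_injective (R := ℂ)
    rw [sub_mul, one_mul, sub_eq_zero] at hpp
    rw [Unitization.inr_mul, ← hpp]
  have h1 := hp₁.isIdempotentElem.eq
  have h2 := hp₁.isSelfAdjoint.star_eq
  have hvp : v * p₁ = v := mul_eq_of_star_mul_eq hp₁ hv1
  have hpv : p₁ * v = v := by
    have h3 : p₁ * (v * star v) * v = v * star v * v := by rw [hv2]
    rwa [mul_assoc, mul_assoc, hv1, hvp] at h3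
  have hvs : v * star v * p₁ = v * star v := by
    rw [mul_assoc, ← h2, ← star_mul, hpv]
  have hvv : v * star v * (v * star v) = v * star v := by
    rw [mul_assoc, ← mul_assoc (star v), hv1, ← mul_assoc, hvp]
  set f := p₁ - v * star v with hf
  have hff : f * f = f := by
    rw [hf, mul_sub, sub_mul, sub_mul, h1, hvs, hv2, hvv]; abel
  have hfs : star f = f := by rw [hf]; simp [h2]
  have hfv : f * v = 0 := by rw [hf, sub_mul, hpv, mul_assoc, hv1, hvp, sub_self]
  have hpf : p₁ * f = f := by rw [hf, mul_sub, h1, hv2]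
  -- Here `t n = vⁿ f`: the isometry `v` of the corner of `p₁` shifts its defect projection `f` onto
  -- pairwise orthogonal copies.
  let t : ℕ → A := fun n => Nat.rec f (fun _ x => v * x) n
  have t0 : t 0 = f := rfl
  have tS : ∀ n, t (n + 1) = v * t n := fun _ => rfl
  have hpt : ∀ n, p₁ * t n = t n := by
    intro n
    cases n with
    | zero => exact hpf
    | succ n => rw [tS, ← mul_assoc, hpv]
  have hft : ∀ n, f * t (n + 1) = 0 := fun n => by rw [tS, ← mul_assoc, hfv, zero_mul]
  refine ⟨f, ⟨hff, hfs⟩, fun h => hv3 (sub_eq_zero.1 h).symm, t, ?_, fun i => ?_⟩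
  · intro i
    induction i with
    | zero =>
      intro j
      cases j with
      | zero => simp [t0, hfs, hff]
      | succ j => simp [t0, hfs, hft]
    | succ i ih =>
      intro j
      cases j with
      | zero =>
        have := congrArg star (hft i)
        rw [star_mul, hfs, star_zero] at this
        simp [t0, this]
      | succ j =>
        rw [tS, tS, star_mul, mul_assoc, ← mul_assoc (star v), hv1, hpt, ih j]
        simp
  · rw [← hpt i, ← mul_assoc, hpp']

/-- Simplicity enters here: the closed span of A f A is a nonzero ideal, hence all of A. -/
theorem exists_sum_near (hA : IsPurelyInfiniteSimple A) {f : A} (hf : IsStarProjection f)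
    (hf0 : f ≠ 0) (k : A) {ε : ℝ} (hε : 0 < ε) : ∃ (n : ℕ) (x y : Fin n → A), ‖k - ∑ i, x i * f * y i‖ < ε := by
  let S : Set A := {a | ∃ x y, a = x * f * y}
  let I : Submodule ℂ A := (Submodule.span ℂ S).topologicalClosure
  have hl : ∀ a x, x ∈ Submodule.span ℂ S → a * x ∈ Submodule.span ℂ S := by
    intro a x hx
    induction hx using Submodule.span_induction with
    | mem x h =>
      obtain ⟨u, w, rfl⟩ := h
      exact Submodule.subset_span ⟨a * u, w, by simp only [mul_assoc]⟩
    | zero => simp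
    | add x y _ _ h1 h2 => rw [mul_add]; exact add_mem h1 h2
    | smul c x _ h => rw [mul_smul_comm]; exact Submodule.smul_mem _ _ h
  have hr : ∀ a x, x ∈ Submodule.span ℂ S → x * a ∈ Submodule.span ℂ S := by
    intro a x hx
    induction hx using Submodule.span_induction with
    | mem x h =>
      obtain ⟨u, w, rfl⟩ := h
      exact Submodule.subset_span ⟨u, w * a, by simp only [mul_assoc]⟩
    | zero => simp
    | add x y _ _ h1 h2 => rw [add_mul]; exact add_mem h1 h2
    | smul c x _ h => rw [smul_mul_assoc]; exact Submodule.smul_mem _ _ h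
  have hI : I = ⊤ := by
    rcases hA.1.2 I (Submodule.isClosed_topologicalClosure _) (fun a x hx =>
      ⟨map_mem_closure (continuous_const.mul continuous_id) hx (fun y hy => hl a y hy),
        map_mem_closure (f := fun y => y * a) (continuous_id.mul continuous_const) hx
          (fun y hy => hr a y hy)⟩) with h | h
    · exfalso
      apply hf0
      have : f ∈ I := Submodule.le_topologicalClosure _ (Submodule.subset_span
        ⟨f, f, by rw [hf.isIdempotentElem.eq, hf.isIdempotentElem.eq]⟩)
      rw [h] at this
      exact this
    · exact h
  have hk : k ∈ closure (Submodule.span ℂ S : Set A) := by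
    have : k ∈ I := by rw [hI]; exact Submodule.mem_top
    exact this
  obtain ⟨d, hd, hkd⟩ := Metric.mem_closure_iff.1 hk ε hε
  obtain ⟨n, x, y, rfl⟩ : ∃ (n : ℕ) (x y : Fin n → A), d = ∑ i, x i * f * y i := by
    clear hkd
    induction hd using Submodule.span_induction with
    | mem x h =>
      obtain ⟨u, w, rfl⟩ := h
      exact ⟨1, fun _ => u, fun _ => w, by simp⟩
    | zero => exact ⟨0, 0, 0, by simp⟩
    | add a b _ _ h1 h2 =>
      obtain ⟨n, x, y, rfl⟩ := h1
      obtain ⟨m, x', y', rfl⟩ := h2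
      exact ⟨n + m, Fin.append x x', Fin.append y y', by simp [Fin.sum_univ_add]⟩
    | smul c a _ h =>
      obtain ⟨n, x, y, rfl⟩ := h
      exact ⟨n, fun i => c • x i, y, by simp [Finset.smul_sum, smul_mul_assoc]⟩
  exact ⟨n, x, y, by rwa [dist_eq_norm] at hkd⟩

/-- The analytic part of comparison: approximate factorizations of `k` through `p`. -/
theorem exists_factor_of_sum_near {B : Type*} [CStarAlgebra B] [PartialOrder B]
    [StarOrderedRing B] {p k h d T : B}
    (hp : IsStarProjection p) (hk : IsSelfAdjoint k) (hkh : k * h = h) (hpT : p * T = T)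
    (hd : ‖k - d‖ ≤ 1 / 2)
    (hT : d + star d ≤ star T * T) :
    ∃ s : B, p * (s * T * h) = s * T * h ∧ star (s * T * h) * (s * T * h) = star h * h := by
  -- The element is at least 1, because `k - d` plus its adjoint has norm at most 1. On `h`, where
  -- `k` acts as the identity, it agrees with `T⋆ T`.
  obtain ⟨G, hG⟩ : IsUnit (star T * T + 2 * (1 - k)) := by
    refine CStarAlgebra.isUnit_of_le (1 : B) ?_
    rw [← sub_nonneg]
    have e : star T * T + 2 * (1 - k) - 1 =
        (star T * T - (d + star d)) + (1 - ((k - d) + star (k - d))) := by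
      rw [star_sub, hk.star_eq]; noncomm_ring
    have hn : ‖(k - d) + star (k - d)‖ ≤ 1 := by
      refine (norm_add_le _ _).trans ?_
      rw [norm_star]; linarith
    have hs : IsSelfAdjoint ((k - d) + star (k - d)) := IsSelfAdjoint.add_star_self _
    have h1 : (k - d) + star (k - d) ≤ 1 := by
      refine hs.le_algebraMap_norm_self.trans ?_
      calc algebraMap ℝ B ‖(k - d) + star (k - d)‖ ≤ algebraMap ℝ B 1 :=
            algebraMap_mono B hn
        _ = 1 := map_one _
    rw [e]
    exact add_nonneg (sub_nonneg.2 hT) (sub_nonneg.2 h1)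
  have hGh : ↑G⁻¹ * (star T * T * h) = h := by
    have : (G : B) * h = star T * T * h := by
      rw [hG, add_mul, mul_assoc 2, sub_mul, one_mul, hkh]; simp
    rw [← this, ← mul_assoc]; simp
  set Y : B := ↑G⁻¹ * star T with hY
  have hN : 0 ≤ star Y * Y := star_mul_self_nonneg Y
  have hYp : Y * p = Y := by
    rw [hY, mul_assoc, ← hp.isSelfAdjoint.star_eq, ← star_mul, hpT]
  have hpY : p * star Y = star Y := by
    simpa [hp.isSelfAdjoint.star_eq] using congrArg star hYp
  -- `Y` inverts `T` on `h`, so `Y T h = h` need not lie under `p`. Replacing `Y` by its absolute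
  -- value keeps `(Y T h)⋆ (Y T h)` and puts the range under `p`.
  set s := CFC.sqrt (star Y * Y)
  have hss : s * s = star Y * Y := CFC.sqrt_mul_sqrt_self _ hN
  have hsa : star s = s := (CFC.sqrt_nonneg _).isSelfAdjoint.star_eq
  have hps : p * s = s := by
    rw [← sub_eq_zero]
    apply eq_zero_of_mul_star_self
    calc (p * s - s) * star (p * s - s)
        = p * (s * s) * p - p * (s * s) - s * s * p + s * s := by
          rw [star_sub, star_mul, hsa, hp.isSelfAdjoint.star_eq]; noncomm_ring
      _ = 0 := by
          rw [hss, ← mul_assoc, hpY, mul_assoc, hYp]; abel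
  refine ⟨s, by simp only [← mul_assoc, hps], ?_⟩
  calc star (s * T * h) * (s * T * h) = star h * star T * (s * s) * T * h := by
        rw [star_mul, star_mul, hsa]; simp only [mul_assoc]
    _ = star (Y * T * h) * (Y * T * h) := by
        rw [hss, star_mul (Y * T), star_mul Y]; simp only [mul_assoc]
    _ = star h * h := by
        rw [hY]
        have : (↑G⁻¹ * star T * T * h : B) = h := by simpa only [mul_assoc] using hGh
        rw [this]

/-- Comparison: an element with a local unit factors through any nonzero projection. -/
theorem exists_factor (hA : IsPurelyInfiniteSimple A) {p : A} (hp : IsStarProjection p)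
    (hp0 : p ≠ 0) {k h : A} (hk : IsSelfAdjoint k) (hkh : k * h = h) :
    ∃ X : A, p * X = X ∧ star X * X = star h * h := by
  obtain ⟨f, hf, hf0, t, ht, hpt⟩ := exists_orthogonal_copies hA hp hp0
  obtain ⟨n, x, y, hxy⟩ := exists_sum_near hA hf hf0 k (ε := 1 / 2) (by norm_num)
  have hff := hf.isIdempotentElem.eq
  have hfs := hf.isSelfAdjoint.star_eq
  have hft : ∀ i, t i * f = t i := fun i => mul_eq_of_star_mul_eq hf (by simp [ht])
  -- The orthogonal copies `t i` of `f` kill the cross terms of `T⋆ T`. Polarization then gives `T⋆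
  -- T = d + d⋆` plus squares, hence `T⋆ T ≥ d + d⋆`.
  let z : Fin n → A := fun i => star (x i) + y i
  let T : A := ∑ i : Fin n, t i * z i
  have hTT : star T * T = ∑ i, star (z i) * f * z i := by
    simp only [T, star_sum, Finset.sum_mul_sum]
    refine Finset.sum_congr rfl fun i _ => ?_
    rw [Finset.sum_eq_single i]
    · rw [star_mul, mul_assoc, ← mul_assoc (star (t i)), ht, if_pos rfl, mul_assoc]
    · intro j _ hj
      rw [star_mul, mul_assoc, ← mul_assoc (star (t i)), ht, if_neg (fun h => hj (Fin.ext h.symm))]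
      simp
    · simp
  have hpT : p * T = T := by
    simp only [T, Finset.mul_sum, ← mul_assoc, hpt]
  let _ := CStarAlgebra.spectralOrder A⁺¹
  have _ := CStarAlgebra.spectralOrderedRing A⁺¹
  set d : A := ∑ i, x i * f * y i with hd
  have hle : (d : A⁺¹) + star (d : A⁺¹) ≤ star (T : A⁺¹) * (T : A⁺¹) := by
    have e : star T * T = (d + star d) + ∑ i, (star (f * star (x i)) * (f * star (x i)) +
        star (f * y i) * (f * y i)) := by
      rw [hTT, hd, star_sum, ← Finset.sum_add_distrib, ← Finset.sum_add_distrib]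
      refine Finset.sum_congr rfl fun i _ => ?_
      have e1 : ∀ a b : A, star (f * a) * (f * b) = star a * f * b := by
        intro a b
        rw [star_mul, hfs, mul_assoc, ← mul_assoc f f, hff, ← mul_assoc]
      rw [e1, e1]
      simp only [z, star_add, star_star, star_mul, hfs, add_mul, mul_add, mul_assoc]
      abel
    have e2 := congrArg (fun a : A => (a : A⁺¹)) e
    simp only [Unitization.inr_mul, Unitization.inr_star, Unitization.inr_add] at e2
    rw [e2]
    refine le_add_of_nonneg_right ?_
    have e3 : ((∑ i, (star (f * star (x i)) * (f * star (x i)) +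
        star (f * y i) * (f * y i)) : A) : A⁺¹) = ∑ i, (star ((f * star (x i) : A) : A⁺¹) *
        ((f * star (x i) : A) : A⁺¹) + star ((f * y i : A) : A⁺¹) * ((f * y i : A) : A⁺¹)) := by
      refine (map_sum (Unitization.inrNonUnitalAlgHom ℂ A) _ _).trans ?_
      simp
    rw [e3]
    exact Finset.sum_nonneg fun i _ =>
      add_nonneg (star_mul_self_nonneg _) (star_mul_self_nonneg _)
  obtain ⟨s, hs1, hs2⟩ := exists_factor_of_sum_near (p := (p : A⁺¹)) (k := (k : A⁺¹))
    (h := (h : A⁺¹)) (d := (d : A⁺¹)) (T := (T : A⁺¹)) hp.inr (hk.inr ℂ)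
    (by rw [← Unitization.inr_mul, hkh]) (by rw [← Unitization.inr_mul, hpT])
    (by rw [← Unitization.inr_sub ℂ, Unitization.norm_inr]; exact hxy.le) hle
  obtain ⟨X, hX⟩ := exists_inr_eq (x := s * (T : A⁺¹) * (h : A⁺¹)) (by simp)
  rw [← hX] at hs1 hs2
  exact ⟨X, Unitization.inr_injective (R := ℂ) (by simpa using hs1),
    Unitization.inr_injective (R := ℂ) (by simpa using hs2)⟩

end PurelyInfinite

section ApproximateUnit

/-! ### Approximate units of projections -/

/-- Rotating the projection `p` by means of `X`, with `X⋆ X = H` and `C² = 1 - H`, gives a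
projection that is a unit for the elements fixed by `H`. -/
theorem isStarProjection_rotation {B : Type*} [CStarAlgebra B] {H C X p : B}
    (hH : IsSelfAdjoint H) (hC : IsSelfAdjoint C) (hp : IsStarProjection p) (hCC : C * C = 1 - H)
    (hCH : C * H = H * C) (hXX : star X * X = H) (hpX : p * X = X) (hpH : p * H = 0)
    (hpC : p * C = p) :
    IsStarProjection (H + X * C + C * star X + (p - X * star X)) ∧
      ∀ m, H * m = m → (H + X * C + C * star X + (p - X * star X)) * m = m := by
  have hps := hp.isSelfAdjoint.star_eq
  have hpp := hp.isIdempotentElem.eq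
  have hHp : H * p = 0 := by simpa [hps, hH.star_eq] using congrArg star hpH
  have hCp : C * p = p := by simpa [hps, hC.star_eq] using congrArg star hpC
  have hXp' : star X * p = star X := by simpa [hps] using congrArg star hpX
  have hXp : X * p = 0 := by
    apply eq_zero_of_star_mul_self
    rw [star_mul, hps, mul_assoc, ← mul_assoc (star X), hXX, hHp, mul_zero]
  have hpX' : p * star X = 0 := by simpa [hps] using congrArg star hXp
  have hHX : H * X = 0 := by rw [← hpX, ← mul_assoc, hHp, zero_mul]
  have hXH : star X * H = 0 := by simpa [hH.star_eq] using congrArg star hHX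
  have hXCX : X * C * X = 0 := by
    rw [mul_assoc]
    calc X * (C * X) = X * (C * (p * X)) := by rw [hpX]
      _ = X * p * X := by rw [← mul_assoc C, hCp, mul_assoc]
      _ = 0 := by rw [hXp, zero_mul]
  have hXCX' : star X * C * star X = 0 := by
    simpa [hC.star_eq, mul_assoc] using congrArg star hXCX
  refine ⟨⟨?_, ?_⟩, fun m hm => ?_⟩
  -- Of the sixteen products of the four summands, the thirteen below simplify; the other three are
  -- `H H`, `H C X⋆` and `X C H`, and they cancel.
  · set q := p - X * star X with hq
    have b1 : H * (X * C) = 0 := by rw [← mul_assoc, hHX, zero_mul]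
    have b2 : H * q = 0 := by rw [hq, mul_sub, hHp, ← mul_assoc, hHX]; simp
    have b3 : X * C * (X * C) = 0 := by rw [← mul_assoc, hXCX, zero_mul]
    have b4 : X * C * (C * star X) = X * star X - X * H * star X := by
      rw [mul_assoc, ← mul_assoc C, hCC, sub_mul, mul_sub, one_mul, mul_assoc X H]
    have b5 : X * C * q = 0 := by
      rw [hq, mul_sub, mul_assoc, hCp, hXp, ← mul_assoc, hXCX]; simp
    have b6 : C * star X * H = 0 := by rw [mul_assoc, hXH, mul_zero]
    have b7 : C * star X * (X * C) = H - H * H := by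
      rw [mul_assoc, ← mul_assoc (star X), hXX, ← mul_assoc, hCH, mul_assoc, hCC, mul_sub, mul_one]
    have b8 : C * star X * (C * star X) = 0 := by
      rw [mul_assoc, ← mul_assoc (star X), hXCX', mul_zero]
    have b9 : C * star X * q = C * star X - H * (C * star X) := by
      rw [hq, mul_sub, mul_assoc, hXp', mul_assoc C, ← mul_assoc (star X), hXX, ← mul_assoc, hCH,
        mul_assoc]
    have b10 : q * H = 0 := by rw [hq, sub_mul, hpH, mul_assoc, hXH]; simp
    have b11 : q * (X * C) = X * C - X * C * H := by
      rw [hq, sub_mul, ← mul_assoc, hpX, mul_assoc X (star X), ← mul_assoc (star X), hXX, ← hCH,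
        mul_assoc X C]
    have b12 : q * (C * star X) = 0 := by
      rw [hq, sub_mul, ← mul_assoc, hpC, hpX', mul_assoc X, ← mul_assoc (star X), hXCX']; simp
    have b13 : q * q = p - X * star X - X * star X + X * H * star X := by
      have c1 : X * star X * p = X * star X := by rw [mul_assoc, hXp']
      have c2 : p * (X * star X) = X * star X := by rw [← mul_assoc, hpX]
      have c3 : X * star X * (X * star X) = X * H * star X := by
        rw [mul_assoc, ← mul_assoc (star X), hXX, ← mul_assoc]
      rw [hq, mul_sub, sub_mul, sub_mul, hpp, c1, c2, c3]; abel
    rw [IsIdempotentElem]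
    simp only [mul_add, add_mul, b1, b2, b3, b4, b5, b6, b7, b8, b9, b10, b11, b12, b13]
    rw [hq]; abel
  · simp only [IsSelfAdjoint, star_add, star_sub, star_mul, star_star, hH.star_eq, hC.star_eq, hps]
    abel
  · have hpm : p * m = 0 := by rw [← hm, ← mul_assoc, hpH, zero_mul]
    have hXm : star X * m = 0 := by rw [← hXp', mul_assoc, hpm, mul_zero]
    have hCm : C * m = 0 := by
      apply eq_zero_of_star_mul_self
      rw [star_mul, hC.star_eq, mul_assoc, ← mul_assoc C, hCC, sub_mul, one_mul, hm]; simp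
    simp only [add_mul, sub_mul, mul_assoc, hm, hXm, hCm, hpm]; simp

variable {A : Type*} [NonUnitalCStarAlgebra A]

theorem exists_inr_eq_cfc {a : A} (f : ℝ → ℝ) (hf0 : f 0 = 0) :
    ∃ b : A, (b : A⁺¹) = cfc f (a : A⁺¹) :=
  ⟨cfcₙ f a, Unitization.real_cfcₙ_eq_cfc_inr a f hf0⟩

/-- The functions of a positive element used to build local units. -/
theorem exists_cutoffs {c : ℝ} (hc : 0 < c) : ∃ fk fh ff fC w fm : ℝ → ℝ,
    (Continuous fk ∧ Continuous fh ∧ Continuous ff ∧ Continuous fC ∧ Continuous w ∧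
      Continuous fm) ∧ (fk 0 = 0 ∧ fh 0 = 0 ∧ ff 0 = 0) ∧ (∀ t, fk t * fh t = fh t) ∧
    (∀ t, (ff t - ff t * ff t) * fk t = 0) ∧ (∀ t, 0 ≤ t → |ff t * t - t| ≤ 3 * c) ∧
    (∀ t, fC t * fC t = 1 - fh t * fh t) ∧ (∀ t, fC t - 1 = fh t * w t) ∧
    (∀ t, fh t * fh t * fm t = fm t) ∧ ∀ t, 0 ≤ t → |t - fm t| ≤ 3 * c := by
  have hneg : ∀ t, t ≤ 0 → clamp (t / c) = 0 := fun t ht =>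
    clamp_of_nonpos (div_nonpos_of_nonpos_of_nonneg ht hc.le)
  have hpos : ∀ t, c ≤ t → clamp (t / c) = 1 := fun t ht => clamp_of_one_le ((one_le_div hc).2 ht)
  have hle : ∀ t, 0 ≤ 1 - clamp t * clamp t := fun t => by
    have h2 := clamp_nonneg t
    have h3 := clamp_le_one t
    nlinarith
  have hfC : Continuous fun t => √(1 - clamp ((t - 2 * c) / c) * clamp ((t - 2 * c) / c)) := by
    fun_prop
  -- The ramps of `ff`, `fk` and `fh` rise on [0, c], [c, 2c] and [2c, 3c], so each is 1 where the
  -- next is nonzero. `fm` is supported where `fh` is 1.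
  refine ⟨fun t => clamp ((t - c) / c), fun t => clamp ((t - 2 * c) / c), fun t => clamp (t / c),
    fun t => √(1 - clamp ((t - 2 * c) / c) * clamp ((t - 2 * c) / c)),
    fun t => -clamp ((t - 2 * c) / c) /
      (1 + √(1 - clamp ((t - 2 * c) / c) * clamp ((t - 2 * c) / c))),
    fun t => max (t - 3 * c) 0,
    ⟨by fun_prop, by fun_prop, by fun_prop, hfC, ?_, by fun_prop⟩,
    ⟨hneg _ (by linarith), hneg _ (by linarith), hneg _ le_rfl⟩, ?_, ?_, ?_, ?_, ?_, ?_, ?_⟩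
  · refine Continuous.div (by fun_prop) (by fun_prop) fun t => ?_
    positivity
  · intro t
    rcases le_total t (2 * c) with h | h
    · simp only [hneg (t - 2 * c) (by linarith), mul_zero]
    · simp only [hpos (t - c) (by linarith), one_mul]
  · intro t
    rcases le_total t c with h | h
    · simp only [hneg (t - c) (by linarith), mul_zero]
    · simp [hpos t h]
  · intro t ht
    rcases le_total t c with h | h
    · have h2 := clamp_nonneg (t / c)
      have h3 := clamp_le_one (t / c)
      rw [abs_le]
      constructor <;> nlinarith
    · simp only [hpos t h, one_mul, sub_self, abs_zero]; positivity
  · exact fun t => Real.mul_self_sqrt (hle _)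
  · intro t
    have h1 := Real.mul_self_sqrt (hle ((t - 2 * c) / c))
    have h2 : 1 + √(1 - clamp ((t - 2 * c) / c) * clamp ((t - 2 * c) / c)) ≠ 0 := by positivity
    rw [mul_div_assoc', eq_div_iff h2]
    linear_combination h1
  · intro t
    rcases le_total t (3 * c) with h | h
    · simp only [max_eq_right (by linarith : t - 3 * c ≤ 0), mul_zero]
    · simp only [hpos (t - 2 * c) (by linarith), one_mul]
  · intro t ht
    rcases le_total t (3 * c) with h | h
    · simp only [max_eq_right (by linarith : t - 3 * c ≤ 0), sub_zero, abs_of_nonneg ht, h]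
    · simp only [max_eq_left (by linarith : 0 ≤ t - 3 * c)]
      rw [sub_sub_cancel, abs_of_pos (by positivity)]

/-- Cut-offs `f`, `k`, `h` of `y y⋆` serve as successive local units. If `f` is a projection, it
will do. Otherwise `f - f²` is nonzero and orthogonal to `k`, which makes room for an infinite
projection `p` orthogonal to `k`. By comparison `h` factors through `p`, and rotating `p` by this
factor gives a projection acting as a unit on the part of `y y⋆` above level 3c. -/
theorem exists_projection_near_unit_of_nonneg (hA : IsPurelyInfiniteSimple A) (y : A) {ε : ℝ}
    (hε : 0 < ε) :
    ∃ e : A, IsStarProjection e ∧ ‖e * (y * star y) - y * star y‖ ≤ ε := by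
  let _ := CStarAlgebra.spectralOrder A⁺¹
  have _ := CStarAlgebra.spectralOrderedRing A⁺¹
  obtain ⟨c, hc, rfl⟩ : ∃ c, 0 < c ∧ 3 * c = ε := ⟨ε / 3, by positivity, by ring⟩
  obtain ⟨fk, fh, ff, fC, w, fm, ⟨ck, ch, cf, cC, cw, cm⟩, ⟨fk0, fh0, ff0⟩, hkh, hffk, hft, hCC,
    hCw, hhm, hm⟩ := exists_cutoffs hc
  set x : A⁺¹ := ((y * star y : A) : A⁺¹) with hxd
  have hx0 : 0 ≤ x := by
    rw [hxd, Unitization.inr_mul, Unitization.inr_star]; exact mul_star_self_nonneg _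
  have hx : IsSelfAdjoint x := hx0.isSelfAdjoint
  have hsp : ∀ t ∈ spectrum ℝ x, 0 ≤ t := fun t ht => spectrum_nonneg_of_nonneg hx0 ht
  obtain ⟨k, hk⟩ := exists_inr_eq_cfc (a := y * star y) fk fk0
  obtain ⟨h, hh⟩ := exists_inr_eq_cfc (a := y * star y) fh fh0
  obtain ⟨f, hf⟩ := exists_inr_eq_cfc (a := y * star y) ff ff0
  rw [← hxd] at hk hh hf
  have hksa : IsSelfAdjoint (k : A⁺¹) := by rw [hk]; exact cfc_predicate fk x
  have hhsa : IsSelfAdjoint (h : A⁺¹) := by rw [hh]; exact cfc_predicate fh x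
  have hfsa : IsSelfAdjoint (f : A⁺¹) := by rw [hf]; exact cfc_predicate ff x
  have hg : ((f - f * f : A) : A⁺¹) = cfc (fun t => ff t - ff t * ff t) x := by
    rw [Unitization.inr_sub, Unitization.inr_mul, hf, cfc_sub ff (fun t => ff t * ff t) x,
      cfc_mul ff ff x]
  have hgk : ((f - f * f : A) : A⁺¹) * k = 0 := by
    rw [hg, hk, ← cfc_mul (fun t => ff t - ff t * ff t) fk x]
    simp only [hffk]
    exact cfc_const_zero ℝ x
  have hkg : (k : A⁺¹) * ((f - f * f : A) : A⁺¹) = 0 := by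
    rw [hg, hk, (cfc_commute_cfc fk (fun t => ff t - ff t * ff t) x).eq, ← hg, ← hk, hgk]
  by_cases hg0 : f - f * f = 0
  · refine ⟨f, ⟨(sub_eq_zero.1 hg0).symm, Unitization.isSelfAdjoint_inr.1 hfsa⟩, ?_⟩
    rw [← Unitization.norm_inr (𝕜 := ℂ), Unitization.inr_sub, Unitization.inr_mul, hf, ← hxd]
    have e : cfc ff x * x - x = cfc (fun t => ff t * t - t) x := by
      rw [cfc_sub (fun t => ff t * t) (fun t => t) x, cfc_mul ff (fun t => t) x, cfc_id' ℝ x]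
    rw [e]
    exact norm_cfc_le (by positivity) fun t ht => hft t (hsp t ht)
  · obtain ⟨p, ⟨hp, v, hv1, hv2, hv3⟩, hkp⟩ :=
      exists_infinite_of_annihilated hA hksa hg0 hkg hgk
    have hp0 : p ≠ 0 := by
      rintro rfl
      apply hv3
      rw [← hv2, zero_mul]
    have hkh' : (k : A⁺¹) * h = h := by
      rw [hk, hh, ← cfc_mul fk fh x]
      simp only [hkh]
    obtain ⟨X, hX1, hX2⟩ := exists_factor hA hp hp0 (k := k) (h := h)
      (Unitization.isSelfAdjoint_inr.1 hksa)
      (Unitization.inr_injective (R := ℂ) (by simpa using hkh'))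
    have hpk : (p : A⁺¹) * k = 0 := by
      simpa [hksa.star_eq, hp.inr.isSelfAdjoint.star_eq] using congrArg star hkp
    have hph : (p : A⁺¹) * h = 0 := by rw [← hkh', ← mul_assoc, hpk, zero_mul]
    obtain ⟨hproj, hunit⟩ := isStarProjection_rotation (H := (h : A⁺¹) * h) (C := cfc fC x)
      (X := (X : A⁺¹)) (p := (p : A⁺¹))
      (by rw [IsSelfAdjoint, star_mul, hhsa.star_eq]) (cfc_predicate fC x) hp.inr
      (by
        rw [hh, ← cfc_mul fC fC x, ← cfc_mul fh fh x, ← cfc_one ℝ x,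
          ← cfc_sub 1 (fun t => fh t * fh t) x]
        exact cfc_congr fun t _ => hCC t)
      (by
        have hcomm : Commute (cfc fC x) (h : A⁺¹) := by rw [hh]; exact cfc_commute_cfc _ _ _
        exact hcomm.mul_right hcomm)
      (by
        rw [← Unitization.inr_star, ← Unitization.inr_mul, hX2, Unitization.inr_mul,
          Unitization.inr_star, hhsa.star_eq])
      (by rw [← Unitization.inr_mul, hX1])
      (by rw [← mul_assoc, hph, zero_mul])
      (by
        -- `C` differs from 1 by a multiple of `h`, which `p` annihilates; hence `p C = p`.
        have e : cfc fC x - 1 = h * cfc w x := by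
          rw [hh, ← cfc_mul fh w x, ← cfc_one ℝ x, ← cfc_sub fC 1 x]
          exact cfc_congr fun t _ => hCw t
        rw [eq_add_of_sub_eq e, mul_add, mul_one, ← mul_assoc, hph, zero_mul, zero_add])
    set E : A⁺¹ := h * h + X * cfc fC x + cfc fC x * star (X : A⁺¹) + (p - X * star (X : A⁺¹))
    obtain ⟨e, he⟩ := exists_inr_eq (x := E) (by simp [E, sub_eq_add_neg])
    refine ⟨e, (Unitization.isStarProjection_inr_iff).1 (he ▸ hproj), ?_⟩
    rw [← Unitization.norm_inr (𝕜 := ℂ), Unitization.inr_sub, Unitization.inr_mul, he, ← hxd]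
    have hEm := hunit (cfc fm x) (by
      rw [hh, ← cfc_mul fh fh x, ← cfc_mul (fun t => fh t * fh t) fm x]
      simp only [hhm])
    have e1 : E * x - x = -((1 - E) * cfc (fun t => t - fm t) x) := by
      rw [cfc_sub (fun t => t) fm x, cfc_id' ℝ x, sub_mul, mul_sub, mul_sub, hEm]
      simp
    rw [e1, norm_neg]
    calc _ ≤ ‖1 - E‖ * ‖cfc (fun t => t - fm t) x‖ := norm_mul_le _ _
      _ ≤ 1 * (3 * c) := by
          gcongr
          · exact IsStarProjection.norm_le _ hproj.one_sub
          · exact norm_cfc_le (by positivity) fun t ht => hm t (hsp t ht)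
      _ = 3 * c := one_mul _

/-- A purely infinite simple algebra has local approximate units of projections. -/
theorem exists_projection_near_unit (hA : IsPurelyInfiniteSimple A) {ι : Type*} (s : Finset ι)
    (y : ι → A) {ε : ℝ} (hε : 0 < ε) :
    ∃ e : A, IsStarProjection e ∧ ∀ i ∈ s, ‖e * y i - y i‖ ≤ ε := by
  let _ := CStarAlgebra.spectralOrder A⁺¹
  have _ := CStarAlgebra.spectralOrderedRing A⁺¹
  have hnn : 0 ≤ ∑ i ∈ s, (y i : A⁺¹) * star (y i : A⁺¹) :=
    Finset.sum_nonneg fun i _ => mul_star_self_nonneg _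
  set a := CFC.sqrt (∑ i ∈ s, (y i : A⁺¹) * star (y i : A⁺¹)) with ha
  have haa : a * a = ∑ i ∈ s, (y i : A⁺¹) * star (y i : A⁺¹) := CFC.sqrt_mul_sqrt_self _ hnn
  have has : star a = a := (CFC.sqrt_nonneg _).isSelfAdjoint.star_eq
  have hfst : (a * a).fst = 0 := by
    rw [haa, ← Unitization.fstHom_apply (R := ℂ), map_sum]
    simp
  obtain ⟨b, hb⟩ := exists_inr_eq (x := a) (by simpa using hfst)
  -- The square is needed because the C⋆-identity bounds the square of the norm of `(1 - e) y i`, by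
  -- domination by `(1 - e) a² (1 - e)`.
  obtain ⟨e, he, hne⟩ := exists_projection_near_unit_of_nonneg hA b (ε := ε ^ 2) (by positivity)
  refine ⟨e, he, fun i hi => ?_⟩
  have hn1 : ‖(1 - e : A⁺¹)‖ ≤ 1 := IsStarProjection.norm_le _ he.inr.one_sub
  have h1 : ((e : A⁺¹) - 1) * (a * a) = ((e * (b * star b) - b * star b : A) : A⁺¹) := by
    simp [hb, has, sub_mul]
  have h2 : ‖(1 - e : A⁺¹) * (a * a) * (1 - e)‖ ≤ ε ^ 2 := by
    calc _ ≤ ‖(1 - e : A⁺¹) * (a * a)‖ * ‖(1 - e : A⁺¹)‖ := norm_mul_le _ _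
      _ ≤ ε ^ 2 * 1 := by
          gcongr
          rw [← norm_neg, ← neg_mul, neg_sub, h1, Unitization.norm_inr]
          exact hne
      _ = ε ^ 2 := mul_one _
  have h3 : ‖(1 - e : A⁺¹) * ((y i : A⁺¹) * star (y i : A⁺¹)) * (1 - e)‖ ≤ ε ^ 2 := by
    refine le_trans (CStarAlgebra.norm_le_norm_of_nonneg_of_le ?_ ?_) h2
    · exact he.inr.one_sub.isSelfAdjoint.conjugate_nonneg (mul_star_self_nonneg _)
    · refine he.inr.one_sub.isSelfAdjoint.conjugate_le_conjugate ?_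
      rw [haa]
      exact Finset.single_le_sum (f := fun i => (y i : A⁺¹) * star (y i : A⁺¹))
        (fun i _ => mul_star_self_nonneg _) hi
  have h4 : (1 - e : A⁺¹) * ((y i : A⁺¹) * star (y i : A⁺¹)) * (1 - e) =
      ((1 - e : A⁺¹) * y i) * star ((1 - e : A⁺¹) * y i) := by
    rw [star_mul, he.inr.one_sub.isSelfAdjoint.star_eq]; simp only [mul_assoc]
  rw [h4, CStarRing.norm_self_mul_star, ← sq] at h3
  have h5 := (pow_le_pow_iff_left₀ (norm_nonneg _) hε.le two_ne_zero).1 h3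
  have h6 : ((e * y i - y i : A) : A⁺¹) = -((1 - e : A⁺¹) * y i) := by simp [sub_mul]
  rwa [← Unitization.norm_inr (𝕜 := ℂ), h6, norm_neg]

end ApproximateUnit

/-! ### Cancellation -/

section VClass

variable {B : Type*} [Ring B] [StarRing B]

/-- The class in `V(B)` of a projection of `B`. -/
def vcls (p : B) (hp : IsStarProjection p) : V B := V.mk (ProjMat.ofElem p hp)

theorem mvn_diagonal_iff {p q : B} :
    MvN (Matrix.diagonal fun _ : Fin 1 => p) (Matrix.diagonal fun _ : Fin 1 => q) ↔
      ProjEquiv p q := by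
  constructor
  · rintro ⟨v, h1, h2⟩
    refine ⟨v 0 0, ?_, ?_⟩
    · simpa [Matrix.mul_apply] using congrFun (congrFun h1 0) 0
    · simpa [Matrix.mul_apply] using congrFun (congrFun h2 0) 0
  · rintro ⟨v, h1, h2⟩
    refine ⟨Matrix.diagonal fun _ => v, ?_, ?_⟩
    · rw [Matrix.diagonal_conjTranspose, Matrix.diagonal_mul_diagonal]
      simp [h1]
    · rw [Matrix.diagonal_conjTranspose, Matrix.diagonal_mul_diagonal]
      simp [h2]

theorem vcls_eq_iff {p q : B} {hp : IsStarProjection p} {hq : IsStarProjection q} :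
    vcls p hp = vcls q hq ↔ ProjEquiv p q :=
  Quotient.eq (r := projSetoid B) |>.trans mvn_diagonal_iff

theorem mvn_diagonal_add {p q : B} (hp : IsStarProjection p) (hq : IsStarProjection q)
    (h : p * q = 0) : MvN (Matrix.diagonal fun _ : Fin 1 => p + q)
      (Matrix.fromBlocks (Matrix.diagonal fun _ : Fin 1 => p) 0 0
        (Matrix.diagonal fun _ : Fin 1 => q)) := by
  have h1 := hp.isIdempotentElem.eq
  have h2 := hq.isIdempotentElem.eq
  have h3 := hp.isSelfAdjoint.star_eq
  have h4 := hq.isSelfAdjoint.star_eq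
  have h' : q * p = 0 := by simpa [h3, h4] using congrArg star h
  have e : ∀ r : B, star r = r →
      (Matrix.diagonal fun _ : Fin 1 => r)ᴴ = Matrix.diagonal fun _ => r := by
    intro r hr
    rw [Matrix.diagonal_conjTranspose]
    congr 1
    funext i
    exact hr
  refine ⟨Matrix.fromCols (Matrix.diagonal fun _ => p) (Matrix.diagonal fun _ => q), ?_, ?_⟩
  · simp [Matrix.conjTranspose_fromCols_eq_fromRows_conjTranspose,
      Matrix.fromCols_mul_fromRows, e p h3, e q h4, h1, h2]
  · simp [Matrix.conjTranspose_fromCols_eq_fromRows_conjTranspose,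
      e p h3, e q h4, h1, h2, h, h']

theorem vcls_add {p q : B} (hp : IsStarProjection p) (hq : IsStarProjection q)
    (hpq : IsStarProjection (p + q)) (h : p * q = 0) :
    vcls (p + q) hpq = vcls p hp + vcls q hq :=
  Quotient.sound (s := projSetoid B) (MvN.trans (ProjMat.ofElem (p + q) hpq).isProj
    (ProjMat.sum _ _).isProj (mvn_diagonal_add hp hq h)
    (ProjMat.sum_mvn (ProjMat.ofElem p hp) (ProjMat.ofElem q hq)).symm)

theorem vcls_add_sub {p q : B} (hp : IsStarProjection p) (hq : IsStarProjection q)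
    (hpq : IsStarProjection (q - p)) (h : q * p = p) :
    vcls q hq = vcls p hp + vcls (q - p) hpq := by
  have h' : p * q = p := by
    simpa [hp.isSelfAdjoint.star_eq, hq.isSelfAdjoint.star_eq] using congrArg star h
  have e : p + (q - p) = q := by abel
  rw [← vcls_add hp hpq (by rwa [e]) (by rw [mul_sub, h', hp.isIdempotentElem.eq, sub_self])]
  congr 1
  exact e.symm

end VClass

section Cancellation

variable {A : Type*} [NonUnitalCStarAlgebra A]

theorem ProjEquiv.inr {p q : A} : ProjEquiv p q → ProjEquiv (p : A⁺¹) (q : A⁺¹) := by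
  rintro ⟨v, rfl, rfl⟩
  exact ⟨v, by simp, by simp⟩

theorem ProjEquiv.of_inr {p q : A} (hp : IsStarProjection p) :
    ProjEquiv (p : A⁺¹) (q : A⁺¹) → ProjEquiv p q := by
  rintro ⟨v, h1, h2⟩
  have h3 := mul_eq_of_mul_star_eq hp.inr h1
  obtain ⟨w, rfl⟩ := exists_inr_eq (x := v) (by rw [← h3]; simp)
  exact ⟨w, Unitization.inr_injective (R := ℂ) (by simpa using h1),
    Unitization.inr_injective (R := ℂ) (by simpa using h2)⟩

/-- `v v⋆` is a projection if `v⋆ v` is. -/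
theorem isStarProjection_mul_star {q v : A} (hq : IsStarProjection q) (h : star v * v = q) :
    IsStarProjection (v * star v) := by
  refine ⟨?_, IsSelfAdjoint.mul_star_self v⟩
  rw [IsIdempotentElem, mul_assoc, ← mul_assoc (star v), h, ← mul_assoc,
    mul_eq_of_star_mul_eq hq h]

theorem isStarProjection_sub {p q : A} (hp : IsStarProjection p) (hq : IsStarProjection q)
    (h : p * q = q) : IsStarProjection (p - q) := by
  have h' : q * p = q := by
    simpa [hp.isSelfAdjoint.star_eq, hq.isSelfAdjoint.star_eq] using congrArg star h
  refine ⟨?_, hp.isSelfAdjoint.sub hq.isSelfAdjoint⟩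
  rw [IsIdempotentElem, mul_sub, sub_mul, sub_mul, h, h', hp.isIdempotentElem.eq,
    hq.isIdempotentElem.eq]
  abel

theorem vcls_inr_sub {p q : A} (hp : IsStarProjection p) (hq : IsStarProjection q)
    (h : q * p = p) : vcls (q : A⁺¹) hq.inr =
      vcls (p : A⁺¹) hp.inr + vcls ((q - p : A) : A⁺¹) (isStarProjection_sub hq hp h).inr := by
  have h1 : IsStarProjection ((q : A⁺¹) - p) := by
    simpa using (isStarProjection_sub hq hp h).inr (R := ℂ)
  rw [vcls_add_sub hp.inr hq.inr h1 (by rw [← Unitization.inr_mul, h])]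
  congr 1
  congr 1
  simp

/-- Every projection is equivalent to a subprojection of a given nonzero one. -/
theorem exists_vcls_eq_add (hA : IsPurelyInfiniteSimple A) {p q : A} (hp : IsStarProjection p)
    (hp0 : p ≠ 0) (hq : IsStarProjection q) :
    ∃ d : V A⁺¹, vcls (p : A⁺¹) hp.inr = vcls (q : A⁺¹) hq.inr + d := by
  have h1 := hq.isIdempotentElem.eq
  obtain ⟨X, hX1, hX2⟩ := exists_factor hA hp hp0 hq.isSelfAdjoint h1
  rw [hq.isSelfAdjoint.star_eq, h1] at hX2
  have h2 := isStarProjection_mul_star hq hX2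
  have h3 : p * (X * star X) = X * star X := by rw [← mul_assoc, hX1]
  refine ⟨vcls ((p - X * star X : A) : A⁺¹) (isStarProjection_sub hp h2 h3).inr, ?_⟩
  rw [vcls_inr_sub h2 hp h3]
  congr 1
  exact vcls_eq_iff.2 (ProjEquiv.inr ⟨X, rfl, hX2⟩)

/-- Cancellation by absorption: `a` contains two orthogonal copies of some nonzero `f`, one of which
contains a copy of `a` and the other a copy of `c`. So [a] = [a] + [c] + z for some z in V(A⁺), and
likewise for any class that is [a] plus something, such as [b]. -/
theorem ProjEquiv.of_vcls_add_eq (hA : IsPurelyInfiniteSimple A) {a b c : A}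
    (ha : IsStarProjection a) (ha0 : a ≠ 0) (hb : IsStarProjection b) (hb0 : b ≠ 0)
    (hc : IsStarProjection c)
    (h : vcls (a : A⁺¹) ha.inr + vcls (c : A⁺¹) hc.inr =
      vcls (b : A⁺¹) hb.inr + vcls (c : A⁺¹) hc.inr) : ProjEquiv a b := by
  obtain ⟨f, hf, hf0, t, ht, hat⟩ := exists_orthogonal_copies hA ha ha0
  have hff := hf.isIdempotentElem.eq
  have htt : ∀ i, star (t i) * t i = f := fun i => by simp [ht]
  have hproj : ∀ i, IsStarProjection (t i * star (t i)) := fun i =>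
    isStarProjection_mul_star hf (htt i)
  have hcls : ∀ i, vcls ((t i * star (t i) : A) : A⁺¹) (hproj i).inr = vcls (f : A⁺¹) hf.inr :=
    fun i => vcls_eq_iff.2 (ProjEquiv.inr ⟨t i, rfl, htt i⟩)
  have hsub : ∀ i, a * (t i * star (t i)) = t i * star (t i) := fun i => by
    rw [← mul_assoc, hat]
  have horth : (t 0 * star (t 0)) * (t 1 * star (t 1)) = 0 := by
    rw [mul_assoc, ← mul_assoc (star (t 0)), ht]; simp
  have e1 := vcls_inr_sub (hproj 0) ha (hsub 0)
  have hsub' : (a - t 0 * star (t 0)) * (t 1 * star (t 1)) = t 1 * star (t 1) := by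
    rw [sub_mul, hsub 1, horth, sub_zero]
  have e2 := vcls_inr_sub (hproj 1) (isStarProjection_sub ha (hproj 0) (hsub 0)) hsub'
  rw [hcls] at e1 e2
  rw [e2] at e1
  obtain ⟨d, hd⟩ := exists_vcls_eq_add hA hf hf0 ha
  obtain ⟨d', hd'⟩ := exists_vcls_eq_add hA hf hf0 hc
  obtain ⟨u, hu⟩ := exists_vcls_eq_add hA hb hb0 ha
  generalize vcls ((a - t 0 * star (t 0) - t 1 * star (t 1) : A) : A⁺¹) _ = g at e1
  -- The rest is arithmetic in a commutative monoid.
  have key : ∀ α β γ φ δ δ' υ g : V A⁺¹, α = φ + (φ + g) → φ = α + δ → φ = γ + δ' → β = α + υ →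
      α + γ = β + γ → α = β := by
    intro α β γ φ δ δ' υ g h1 h2 h3 h4 h5
    have h6 : α = α + (δ + (γ + δ') + g) := by
      calc α = φ + (φ + g) := h1
        _ = (α + δ) + ((γ + δ') + g) := by rw [← h2, ← h3]
        _ = _ := by abel
    calc α = α + γ + (δ + δ' + g) := by
          conv_lhs => rw [h6]
          abel
      _ = (α + (δ + (γ + δ') + g)) + υ := by rw [h5, h4]; abel
      _ = β := by rw [← h6, h4]
  refine ProjEquiv.of_inr ha (vcls_eq_iff (hp := ha.inr) (hq := hb.inr).1 ?_)
  exact key _ _ _ _ _ _ _ _ e1 hd hd' hu h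

end Cancellation

/-! ### Projections with the same `K₀`-class -/

section Compression

variable {B : Type*} [CStarAlgebra B] {ι : Type*} [Fintype ι]

/-- The compression `∑ sᵢ Xᵢⱼ sⱼ⋆` of a matrix. -/
def compress (s : ι → B) (X : Matrix ι ι B) : B := ∑ i, ∑ j, s i * X i j * star (s j)

theorem compress_add (s : ι → B) (X Y : Matrix ι ι B) :
    compress s (X + Y) = compress s X + compress s Y := by
  simp [compress, mul_add, add_mul, Finset.sum_add_distrib]

theorem star_compress (s : ι → B) (X : Matrix ι ι B) :
    star (compress s X) = compress s Xᴴ := by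
  simp only [compress, star_sum, star_mul, star_star, Matrix.conjTranspose_apply]
  rw [Finset.sum_comm]
  simp only [mul_assoc]

variable [DecidableEq ι]

theorem compress_mul (s : ι → B) {e : B}
    (hs : ∀ i j, star (s i) * s j = if i = j then e else 0) (X Y : Matrix ι ι B) :
    compress s X * compress s Y = ∑ i, ∑ k, ∑ j, s i * (X i k * e * Y k j) * star (s j) := by
  simp only [compress, Finset.sum_mul]
  refine Finset.sum_congr rfl fun i _ => Finset.sum_congr rfl fun k _ => ?_
  rw [Finset.mul_sum, Finset.sum_eq_single k]
  · rw [Finset.mul_sum]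
    refine Finset.sum_congr rfl fun j _ => ?_
    have := hs k k
    rw [if_pos rfl] at this
    rw [← this]
    simp only [mul_assoc]
  · intro l _ hl
    rw [Finset.mul_sum]
    refine Finset.sum_eq_zero fun j _ => ?_
    have := hs k l
    rw [if_neg (Ne.symm hl)] at this
    calc _ = s i * X i k * (star (s k) * s l) * Y l j * star (s j) := by simp only [mul_assoc]
      _ = 0 := by rw [this]; simp
  · simp

/-- Compression would be multiplicative if `e` commuted with the entries, since `s i * e = s i`; the
error is governed by the commutators. -/
theorem norm_compress_mul_sub_le (s : ι → B) {e : B} (he : IsStarProjection e)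
    (hs : ∀ i j, star (s i) * s j = if i = j then e else 0) (X Y : Matrix ι ι B) {δ : ℝ}
    (hδ : ∀ i j, ‖X i j * e - e * X i j‖ ≤ δ) :
    ‖compress s X * compress s Y - compress s (X * Y)‖ ≤
      ∑ _i : ι, ∑ k, ∑ j, δ * ‖Y k j‖ := by
  have hse : ∀ i, s i * e = s i := fun i => mul_eq_of_star_mul_eq he (by simp [hs])
  have hsn : ∀ i, ‖s i‖ ≤ 1 := by
    intro i
    have h1 : ‖s i‖ * ‖s i‖ ≤ 1 := by
      rw [← CStarRing.norm_star_mul_self, hs, if_pos rfl]; exact IsStarProjection.norm_le e he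
    nlinarith [norm_nonneg (s i)]
  have e1 : compress s (X * Y) = ∑ i, ∑ k, ∑ j, s i * (e * X i k * Y k j) * star (s j) := by
    unfold compress
    refine Finset.sum_congr rfl fun i _ => ?_
    rw [Finset.sum_comm]
    refine Finset.sum_congr rfl fun j _ => ?_
    rw [Matrix.mul_apply, Finset.mul_sum, Finset.sum_mul]
    refine Finset.sum_congr rfl fun k _ => ?_
    simp only [← mul_assoc, hse]
  rw [compress_mul s hs, e1]
  simp only [← Finset.sum_sub_distrib]
  refine norm_sum_le_of_le _ fun i _ => norm_sum_le_of_le _ fun k _ => norm_sum_le_of_le _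
    fun j _ => ?_
  have e2 : s i * (X i k * e * Y k j) * star (s j) - s i * (e * X i k * Y k j) * star (s j) =
      s i * ((X i k * e - e * X i k) * Y k j) * star (s j) := by noncomm_ring
  rw [e2]
  calc _ ≤ ‖s i‖ * ‖(X i k * e - e * X i k) * Y k j‖ * ‖star (s j)‖ := norm_mul₃_le
    _ ≤ 1 * (δ * ‖Y k j‖) * 1 := by
        have h0 : 0 ≤ δ := (norm_nonneg _).trans (hδ i k)
        gcongr
        · exact hsn i
        · exact (norm_mul_le _ _).trans (by gcongr; exact hδ i k)
        · rw [norm_star]; exact hsn j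
    _ = δ * ‖Y k j‖ := by ring

end Compression

section K0Class

variable {A : Type*} [NonUnitalCStarAlgebra A]

theorem norm_commutator_le {e : A} (he : IsStarProjection e) (x : A⁺¹) {δ : ℝ}
    (h1 : ‖e * x.snd - x.snd‖ ≤ δ) (h2 : ‖e * star x.snd - star x.snd‖ ≤ δ) :
    ‖x * (e : A⁺¹) - e * x‖ ≤ 2 * δ := by
  have e1 : x * (e : A⁺¹) - e * x = ((star (e * star x.snd - star x.snd) -
      (e * x.snd - x.snd) : A) : A⁺¹) := by
    have hx : x = algebraMap ℂ A⁺¹ x.fst + (x.snd : A⁺¹) := by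
      ext <;> simp [Unitization.algebraMap_eq_inl]
    have hc := Algebra.commutes x.fst (e : A⁺¹)
    generalize algebraMap ℂ A⁺¹ x.fst = l at hx hc
    conv_lhs => rw [hx]
    rw [add_mul, mul_add, hc]
    simp [he.isSelfAdjoint.star_eq]
  rw [e1, Unitization.norm_inr]
  calc _ ≤ ‖star (e * star x.snd - star x.snd)‖ + ‖e * x.snd - x.snd‖ := norm_sub_le _ _
    _ ≤ δ + δ := by rw [norm_star]; gcongr
    _ = 2 * δ := by ring

/-- Replaces matrices over A⁺ by elements of A while nearly keeping the given products. The
projection `e` is an approximate unit for the A-parts of the entries and commutes with their scalar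
parts, and comparison provides copies `s i` of `e` with orthogonal ranges. -/
theorem exists_compression (hA : IsPurelyInfiniteSimple A) {ι κ : Type*} [Fintype ι]
    [DecidableEq ι] [Fintype κ] (M : κ → Matrix ι ι A⁺¹) {ε : ℝ} (hε : 0 < ε) :
    ∃ (e : A) (s : ι → A), IsStarProjection e ∧
      (∀ i j, star (s i) * s j = if i = j then e else 0) ∧
      (∀ k i j, ‖e * (M k i j).snd - (M k i j).snd‖ ≤ ε) ∧
      ∀ k l, ‖compress (fun i => (s i : A⁺¹)) (M k) * compress (fun i => (s i : A⁺¹)) (M l) -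
        compress (fun i => (s i : A⁺¹)) (M k * M l)‖ ≤ ε := by
  set N : ℝ := ∑ l : κ, ∑ _i : ι, ∑ k, ∑ j, ‖M l k j‖ with hN
  have hN0 : 0 ≤ N := by positivity
  -- The commutators with `e` are at most 2δ, and the second term of the minimum makes 2δN at most
  -- ε.
  set δ : ℝ := min ε (ε / (2 * (1 + N))) with hδd
  have hδ : 0 < δ := lt_min hε (by positivity)
  obtain ⟨e, he, hap⟩ := exists_projection_near_unit hA (Finset.univ : Finset (κ × ι × ι × Bool))
    (fun x => if x.2.2.2 then (M x.1 x.2.1 x.2.2.1).snd else star (M x.1 x.2.1 x.2.2.1).snd) hδ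
  have h1 : ∀ k i j, ‖e * (M k i j).snd - (M k i j).snd‖ ≤ δ := fun k i j => by
    simpa using hap (k, i, j, true) (Finset.mem_univ _)
  have h2 : ∀ k i j, ‖e * star (M k i j).snd - star (M k i j).snd‖ ≤ δ := fun k i j => by
    simpa using hap (k, i, j, false) (Finset.mem_univ _)
  have _ := hA.1.1
  obtain ⟨z, hz⟩ := exists_ne (0 : A)
  obtain ⟨p₀, ⟨hp₀, v, hv1, hv2, hv3⟩, -⟩ := exists_infinite_of_annihilated hA
    (b := (0 : A⁺¹)) (IsSelfAdjoint.zero _) hz (by simp) (by simp)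
  have hp₀0 : p₀ ≠ 0 := by
    rintro rfl
    apply hv3
    rw [← hv2, zero_mul]
  obtain ⟨f, hf, hf0, t, ht, -⟩ := exists_orthogonal_copies hA hp₀ hp₀0
  obtain ⟨X, hX1, hX2⟩ := exists_factor hA hf hf0 he.isSelfAdjoint he.isIdempotentElem.eq
  rw [he.isSelfAdjoint.star_eq, he.isIdempotentElem.eq] at hX2
  let idx : ι → ℕ := fun i => (Fintype.equivFin ι i : ℕ)
  have hidx : ∀ i j, idx i = idx j ↔ i = j := fun i j =>
    Fin.val_injective.eq_iff.trans (Fintype.equivFin ι).injective.eq_iff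
  have hs : ∀ i j, star (t (idx i) * X) * (t (idx j) * X) = if i = j then e else 0 := by
    intro i j
    rw [star_mul, mul_assoc, ← mul_assoc (star (t _)), ht]
    simp only [hidx]
    split_ifs
    · rw [hX1, hX2]
    · simp
  refine ⟨e, fun i => t (idx i) * X, he, hs, fun k i j => (h1 k i j).trans (min_le_left _ _),
    fun k l => ?_⟩
  refine (norm_compress_mul_sub_le _ he.inr (fun i j => ?_) _ _ (fun i j =>
    norm_commutator_le he _ (h1 k i j) (h2 k i j))).trans ?_
  · rw [← Unitization.inr_star, ← Unitization.inr_mul, hs]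
    split_ifs <;> simp
  · simp only [← Finset.mul_sum]
    have h3 : ∑ _i : ι, ∑ k, ∑ j, ‖M l k j‖ ≤ N :=
      Finset.single_le_sum (f := fun l => ∑ _i : ι, ∑ k, ∑ j, ‖M l k j‖)
        (fun l _ => by positivity) (Finset.mem_univ l)
    have h4 : δ * (2 * (1 + N)) ≤ ε := by
      rw [← le_div_iff₀ (by positivity)]; exact min_le_right _ _
    calc _ ≤ 2 * δ * N := by gcongr
      _ ≤ ε := by nlinarith

-- The stabilizing `r` is a matrix over A⁺ and may have a nonzero scalar part, whereas cancellation
-- needs a projection of A. Compression takes values in A: the images of `p` and `r` are near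
-- orthogonal projections `p'` and `c`, with `p'` equivalent to `p`, and likewise for `q`. The image
-- of the partial isometry `W` nearly implements an equivalence between `p' + c` and `q' + c`, which
-- is then corrected to an exact one.
set_option maxHeartbeats 800000 in
theorem exists_vcls_add_eq_of_mvn (hA : IsPurelyInfiniteSimple A) {p q : A}
    (hp : IsStarProjection p) (hq : IsStarProjection q) {n : ℕ}
    {r : Matrix (Fin n) (Fin n) A⁺¹} (hr : IsStarProjection r)
    (h : MvN (Matrix.fromBlocks (Matrix.diagonal fun _ : Fin 1 => (p : A⁺¹)) 0 0 r)
      (Matrix.fromBlocks (Matrix.diagonal fun _ : Fin 1 => (q : A⁺¹)) 0 0 r)) :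
    ∃ (c : A) (hc : IsStarProjection c),
      vcls (p : A⁺¹) hp.inr + vcls (c : A⁺¹) hc.inr =
        vcls (q : A⁺¹) hq.inr + vcls (c : A⁺¹) hc.inr := by
  obtain ⟨W, hW1, hW2⟩ := h
  have hrr := hr.isIdempotentElem.eq
  have hrs : rᴴ = r := hr.isSelfAdjoint.star_eq
  let D : A → Matrix (Fin 1 ⊕ Fin n) (Fin 1 ⊕ Fin n) A⁺¹ := fun a =>
    Matrix.fromBlocks (Matrix.diagonal fun _ => (a : A⁺¹)) 0 0 0
  let R : Matrix (Fin 1 ⊕ Fin n) (Fin 1 ⊕ Fin n) A⁺¹ := Matrix.fromBlocks 0 0 0 r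
  -- The numerals passed to `hap` and `hmul` below are positions in this list.
  obtain ⟨e, s, he, hs, hap, hmul⟩ := exists_compression hA ![W, Wᴴ, R, D p, D q]
    (ε := 1 / 100) (by norm_num)
  set Φ := compress (fun i => (s i : A⁺¹)) with hΦ
  set s₀ : A⁺¹ := (s (Sum.inl 0) : A⁺¹) with hs₀
  have hss₀ : star s₀ * s₀ = e := by
    rw [hs₀, ← Unitization.inr_star, ← Unitization.inr_mul, hs, if_pos rfl]
  have hΦA : ∀ X, (Φ X).fst = 0 := by
    intro X
    rw [hΦ, compress, ← Unitization.fstHom_apply (R := ℂ), map_sum]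
    refine Finset.sum_eq_zero fun i _ => ?_
    rw [map_sum]
    simp
  have hΦD : ∀ a, Φ (D a) = s₀ * a * star s₀ := by
    intro a
    simp [hΦ, compress, D, Fintype.sum_sum_type, hs₀]
  have hsR : star s₀ * Φ R = 0 := by
    have : ∀ j : Fin n, star s₀ * (s (Sum.inr j) : A⁺¹) = 0 := fun j => by
      rw [hs₀, ← Unitization.inr_star, ← Unitization.inr_mul, hs]; simp
    simp [hΦ, compress, R, Fintype.sum_sum_type, Finset.mul_sum, ← mul_assoc, this]
  have hDsnd : ∀ a, (D a (Sum.inl 0) (Sum.inl 0)).snd = a := fun a => by simp [D]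
  have near : ∀ X, Xᴴ = X → X * X = X → ‖Φ X * Φ X - Φ (X * X)‖ ≤ 1 / 100 →
      ∃ c, IsStarProjection c ∧ ‖c - Φ X‖ ≤ 2 / 100 ∧ ∃ y, c = Φ X * y := by
    intro X hX hXX hn
    rw [hXX] at hn
    obtain ⟨c, h1, h2, h3⟩ := exists_projection_near (x := Φ X)
      (by rw [IsSelfAdjoint, hΦ, star_compress, hX]) (by norm_num) hn
    exact ⟨c, h1, by linarith, h3⟩
  obtain ⟨c, hc, hcR, y, hcy⟩ := near R
    (by simp [R, Matrix.fromBlocks_conjTranspose, hrs])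
    (by simp [R, Matrix.fromBlocks_multiply, hrr]) (hmul 2 2)
  have corner : ∀ a : A, IsStarProjection a → ‖Φ (D a) * Φ (D a) - Φ (D a * D a)‖ ≤ 1 / 100 →
      ‖e * a - a‖ ≤ 1 / 100 →
      ∃ a' : A⁺¹, ∃ ha' : IsStarProjection a', ∃ ha : IsStarProjection (a : A⁺¹),
        ∃ hac : IsStarProjection (a' + c), ‖a' - Φ (D a)‖ ≤ 2 / 100 ∧
          vcls (a : A⁺¹) ha + vcls c hc = vcls (a' + c) hac := by
    intro a ha hn hea
    have haa := ha.isIdempotentElem.eq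
    have has := ha.isSelfAdjoint.star_eq
    obtain ⟨a', ha', h1, y', hy'⟩ := near (D a)
      (by
        simp only [D, Matrix.fromBlocks_conjTranspose, Matrix.diagonal_conjTranspose]
        congr 1
        · congr 1
          funext i
          exact ha.inr.isSelfAdjoint.star_eq
        all_goals simp)
      (by simp [D, Matrix.fromBlocks_multiply, ← Unitization.inr_mul, haa]) hn
    -- Orthogonality is exact: `a'` and `c` are multiples of `Φ (D a)` and `Φ R`, whose product
    -- vanishes because the `s i` have orthogonal ranges.
    have horth : a' * c = 0 := by
      rw [← ha'.isSelfAdjoint.star_eq, hy', hcy, hΦD]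
      simp only [star_mul, star_star, mul_assoc]
      rw [← mul_assoc (star s₀), hsR]
      simp
    have hequiv : ProjEquiv a' (a : A⁺¹) := by
      refine ProjEquiv.of_approx (x := s₀ * a) ha' ha.inr ?_ ?_
      · have : s₀ * (a : A⁺¹) * star (s₀ * (a : A⁺¹)) = Φ (D a) := by
          rw [hΦD, star_mul, ha.inr.isSelfAdjoint.star_eq, mul_assoc, ← mul_assoc (a : A⁺¹),
            ← Unitization.inr_mul, haa, mul_assoc]
        rw [this, norm_sub_rev]
        linarith
      · have : star (s₀ * (a : A⁺¹)) * (s₀ * (a : A⁺¹)) - a = ((a * (e * a - a) : A) : A⁺¹) := by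
          rw [star_mul, ha.inr.isSelfAdjoint.star_eq, mul_assoc, ← mul_assoc (star s₀), hss₀]
          simp [mul_sub, ← Unitization.inr_mul, haa]
        rw [this, Unitization.norm_inr]
        calc _ ≤ ‖a‖ * ‖e * a - a‖ := norm_mul_le _ _
          _ ≤ 1 * (1 / 100) := by gcongr; exact IsStarProjection.norm_le a ha
          _ ≤ 1 / 4 := by norm_num
    have hac : IsStarProjection (a' + c) := ha'.add hc horth
    refine ⟨a', ha', ha.inr, hac, h1, ?_⟩
    rw [vcls_add ha' hc hac horth, vcls_eq_iff.2 hequiv]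
  obtain ⟨p', hp', hp1, hpc, hpn, hpe⟩ := corner p hp (hmul 3 3)
    (by
      have h1 := hap 3 (Sum.inl 0) (Sum.inl 0)
      rwa [show ![W, Wᴴ, R, D p, D q] 3 = D p from rfl, hDsnd] at h1)
  obtain ⟨q', hq', hq1, hqc, hqn, hqe⟩ := corner q hq (hmul 4 4)
    (by
      have h1 := hap 4 (Sum.inl 0) (Sum.inl 0)
      rwa [show ![W, Wᴴ, R, D p, D q] 4 = D q from rfl, hDsnd] at h1)
  obtain ⟨c₀, rfl⟩ := exists_inr_eq (x := c) (by rw [hcy]; simp [hΦA])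
  refine ⟨c₀, Unitization.isStarProjection_inr_iff.1 hc, ?_⟩
  have split : ∀ a : A, Matrix.fromBlocks (Matrix.diagonal fun _ : Fin 1 => (a : A⁺¹)) 0 0 r =
      D a + R := fun a => by simp [D, R, Matrix.fromBlocks_add]
  rw [split] at hW1 hW2
  have bound : ∀ x a d : A⁺¹, ∀ b : A, ‖x - Φ (D b + R)‖ ≤ 1 / 100 → ‖a - Φ (D b)‖ ≤ 2 / 100 →
      ‖d - Φ R‖ ≤ 2 / 100 → ‖x - (a + d)‖ ≤ 1 / 4 := by
    intro x a d b h1 h2 h3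
    have : x - (a + d) = (x - Φ (D b + R)) - ((a - Φ (D b)) + (d - Φ R)) := by
      rw [hΦ, compress_add]; abel
    rw [this]
    have h4 := norm_sub_le (x - Φ (D b + R)) ((a - Φ (D b)) + (d - Φ R))
    have h5 := norm_add_le (a - Φ (D b)) (d - Φ R)
    linarith
  have hfinal : ProjEquiv (p' + (c₀ : A⁺¹)) (q' + (c₀ : A⁺¹)) := by
    refine ProjEquiv.of_approx (x := Φ W) hpc hqc ?_ ?_
    · refine bound _ _ _ p ?_ hpn hcR
      have := hmul 0 1
      rw [hΦ, star_compress, ← hΦ, ← hW1]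
      exact this
    · refine bound _ _ _ q ?_ hqn hcR
      have := hmul 1 0
      rw [hΦ, star_compress, ← hΦ, ← hW2]
      exact this
  exact hpe.trans ((vcls_eq_iff.2 hfinal).trans hqe.symm)

/-- Nonzero projections with the same class in `K₀` are equivalent. -/
theorem ProjEquiv.of_cls_eq (hA : IsPurelyInfiniteSimple A) {p q : A} (hp : IsStarProjection p)
    (hp0 : p ≠ 0) (hq : IsStarProjection q) (hq0 : q ≠ 0) (h : K0.cls p hp = K0.cls q hq) :
    ProjEquiv p q := by
  have h1 : Algebra.GrothendieckAddGroup.of (vcls (p : A⁺¹) hp.inr) =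
      Algebra.GrothendieckAddGroup.of (vcls (q : A⁺¹) hq.inr) := congrArg Subtype.val h
  obtain ⟨z, hz⟩ := (AddLocalization.addMonoidOf (⊤ : AddSubmonoid (V A⁺¹))).eq_iff_exists.1 h1
  obtain ⟨r, hr⟩ := Quotient.exists_rep z.1
  rw [← hr] at hz
  have hz' : vcls (p : A⁺¹) hp.inr + V.mk r = vcls (q : A⁺¹) hq.inr + V.mk r := by
    rw [add_comm, add_comm (vcls (q : A⁺¹) hq.inr)]; exact hz
  have hz2 : ProjMat.Equivalent ((ProjMat.ofElem (p : A⁺¹) hp.inr).sum r)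
    ((ProjMat.ofElem (q : A⁺¹) hq.inr).sum r) := Quotient.exact hz'
  have h3 := MvN.trans (isStarProjection_blocks (ProjMat.ofElem (p : A⁺¹) hp.inr).isProj r.isProj)
    (ProjMat.sum _ _).isProj (ProjMat.sum_mvn (ProjMat.ofElem (p : A⁺¹) hp.inr) r).symm hz2
  have h4 := MvN.trans (isStarProjection_blocks (ProjMat.ofElem (p : A⁺¹) hp.inr).isProj r.isProj)
    (isStarProjection_blocks (ProjMat.ofElem (q : A⁺¹) hq.inr).isProj r.isProj) h3
    (ProjMat.sum_mvn (ProjMat.ofElem (q : A⁺¹) hq.inr) r)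
  obtain ⟨c, hc, hcc⟩ := exists_vcls_add_eq_of_mvn hA hp hq r.isProj h4
  exact ProjEquiv.of_vcls_add_eq hA hp hp0 hq hq0 hc hcc

theorem cls_eq_of_projEquiv {p q : A} {hp : IsStarProjection p} {hq : IsStarProjection q}
    (h : ProjEquiv p q) : K0.cls p hp = K0.cls q hq :=
  Subtype.ext (congrArg Algebra.GrothendieckAddGroup.of
    (vcls_eq_iff (hp := hp.inr) (hq := hq.inr).2 h.inr))

end K0Class

/-! ### Unitary equivalence of projections -/

section Unitary

/-- The unitary is the sum of the three partial isometries, whose cross products all vanish. -/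
theorem exists_unitary_of_projEquiv {B : Type*} [CStarAlgebra B] {p₁ p₂ p₃ q₁ q₂ q₃ : B}
    (hp₁ : IsStarProjection p₁) (hp₂ : IsStarProjection p₂) (hp₃ : IsStarProjection p₃)
    (hq₁ : IsStarProjection q₁) (hq₂ : IsStarProjection q₂) (hq₃ : IsStarProjection q₃)
    (hp : p₁ + p₂ + p₃ = 1) (hq : q₁ + q₂ + q₃ = 1) (hp₁₂ : p₁ * p₂ = 0) (hq₁₂ : q₁ * q₂ = 0)
    (h₁ : ProjEquiv q₁ p₁) (h₂ : ProjEquiv q₂ p₂) (h₃ : ProjEquiv q₃ p₃) :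
    ∃ u ∈ unitary B, u * p₁ * star u = q₁ ∧ u * p₂ * star u = q₂ := by
  have orth : ∀ {a b c : B}, IsStarProjection a → IsStarProjection b → a + b + c = 1 →
      a * b = 0 → a * c = 0 ∧ b * c = 0 := by
    intro a b c ha hb h hab
    have hba : b * a = 0 := by
      simpa [ha.isSelfAdjoint.star_eq, hb.isSelfAdjoint.star_eq] using congrArg star hab
    have hc : c = 1 - (a + b) := by rw [← h]; abel
    constructor
    · rw [hc, mul_sub, mul_add, ha.isIdempotentElem.eq, hab]; simp
    · rw [hc, mul_sub, mul_add, hb.isIdempotentElem.eq, hba]; simp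
  obtain ⟨hp₁₃, hp₂₃⟩ := orth hp₁ hp₂ hp hp₁₂
  obtain ⟨hq₁₃, hq₂₃⟩ := orth hq₁ hq₂ hq hq₁₂
  obtain ⟨v₁, a₁, b₁⟩ := h₁
  obtain ⟨v₂, a₂, b₂⟩ := h₂
  obtain ⟨v₃, a₃, b₃⟩ := h₃
  have right : ∀ {v w a b : B}, IsStarProjection a → IsStarProjection b → star v * v = a →
      star w * w = b → a * b = 0 → v * star w = 0 ∧ w * star v = 0 := by
    intro v w a b ha hb hv hw hab
    have : v * star w = 0 := by
      rw [← mul_eq_of_star_mul_eq ha hv, ← mul_eq_of_star_mul_eq hb hw, star_mul,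
        hb.isSelfAdjoint.star_eq, mul_assoc, ← mul_assoc a, hab]
      simp
    exact ⟨this, by simpa using congrArg star this⟩
  have left : ∀ {v w a b : B}, IsStarProjection a → IsStarProjection b → v * star v = a →
      w * star w = b → a * b = 0 → star v * w = 0 ∧ star w * v = 0 := by
    intro v w a b ha hb hv hw hab
    simpa using right ha hb (v := star v) (w := star w) (by simpa using hv) (by simpa using hw) hab
  obtain ⟨r1, r2⟩ := right hp₁ hp₂ b₁ b₂ hp₁₂
  obtain ⟨r3, r4⟩ := right hp₁ hp₃ b₁ b₃ hp₁₃
  obtain ⟨r5, r6⟩ := right hp₂ hp₃ b₂ b₃ hp₂₃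
  obtain ⟨l1, l2⟩ := left hq₁ hq₂ a₁ a₂ hq₁₂
  obtain ⟨l3, l4⟩ := left hq₁ hq₃ a₁ a₃ hq₁₃
  obtain ⟨l5, l6⟩ := left hq₂ hq₃ a₂ a₃ hq₂₃
  refine ⟨v₁ + v₂ + v₃, Unitary.mem_iff.2 ⟨?_, ?_⟩, ?_, ?_⟩
  · simp [add_mul, mul_add, l1, l2, l3, l4, l5, l6, b₁, b₂, b₃, hp]
  · simp [add_mul, mul_add, r1, r2, r3, r4, r5, r6, a₁, a₂, a₃, hq]
  · rw [← b₁]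
    simp only [add_mul, mul_add, star_add, ← mul_assoc, a₁, r2, r4]
    simp only [mul_assoc, r1, r3, zero_mul, mul_zero, add_zero]
    rw [← a₁, mul_assoc, ← mul_assoc (star v₁), b₁, ← mul_assoc, mul_eq_of_star_mul_eq hp₁ b₁]
  · rw [← b₂]
    simp only [add_mul, mul_add, star_add, ← mul_assoc, a₂, r1, r6]
    simp only [mul_assoc, r2, r5, zero_mul, mul_zero, add_zero, zero_add]
    rw [← a₂, mul_assoc, ← mul_assoc (star v₂), b₂, ← mul_assoc, mul_eq_of_star_mul_eq hp₂ b₂]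

variable {A : Type*} [NonUnitalCStarAlgebra A]

/-- Both `[p] + [e - p]` and `[q] + [e - q]` equal `[e]`, so cancellation applies to the nonzero
differences; adding `1 - e` gives the complements in A⁺. -/
theorem ProjEquiv.one_sub_of_le (hA : IsPurelyInfiniteSimple A) {p q e : A}
    (hp : IsStarProjection p) (hq : IsStarProjection q) (he : IsStarProjection e)
    (hep : e * p = p) (heq : e * q = q) (hpe : p ≠ e) (hqe : q ≠ e) (h : ProjEquiv p q) :
    ProjEquiv (1 - (p : A⁺¹)) (1 - (q : A⁺¹)) := by
  have h1 := isStarProjection_sub he hp hep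
  have h2 := isStarProjection_sub he hq heq
  have h3 : ProjEquiv (e - p) (e - q) := by
    refine ProjEquiv.of_vcls_add_eq hA h1 (sub_ne_zero.2 hpe.symm) h2 (sub_ne_zero.2 hqe.symm) hp ?_
    have e1 := vcls_inr_sub hp he hep
    have e2 := vcls_inr_sub hq he heq
    rw [add_comm, ← e1, e2, add_comm, vcls_eq_iff.2 h.inr]
  have key : ∀ r : A, e * r = r → (1 - (e : A⁺¹)) * ((e - r : A) : A⁺¹) = 0 := by
    intro r hr
    rw [sub_mul, one_mul, ← Unitization.inr_mul, mul_sub, he.isIdempotentElem.eq, hr, sub_self]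
  have h4 := ProjEquiv.add he.inr.one_sub he.inr.one_sub h1.inr h2.inr (key p hep) (key q heq)
    (ProjEquiv.refl he.inr.one_sub) h3.inr
  have e3 : ∀ r : A, (1 - (e : A⁺¹)) + ((e - r : A) : A⁺¹) = 1 - r := by
    intro r; rw [Unitization.inr_sub]; abel
  rwa [e3, e3] at h4

/-- The compression `e p e` is almost idempotent, and a projection divisible by it on the left lies
under `e`. -/
theorem exists_subprojection_near {e p : A} (he : IsStarProjection e) (hp : IsStarProjection p)
    (h : ‖e * p - p‖ ≤ 1 / 100) :
    ∃ r : A, IsStarProjection r ∧ e * r = r ∧ ‖(r : A⁺¹) - p‖ < 1 := by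
  have hes := he.isSelfAdjoint.star_eq
  have hps := hp.isSelfAdjoint.star_eq
  have hpp := hp.isIdempotentElem.eq
  have hen := IsStarProjection.norm_le e he
  have hpn := IsStarProjection.norm_le p hp
  have h' : ‖p * e - p‖ ≤ 1 / 100 := by
    rw [← norm_star]; simpa [hes, hps] using h
  set x := e * p * e with hx
  have hxp : ‖x - p‖ ≤ 2 / 100 := by
    have e1 : x - p = (e * p - p) * e + (p * e - p) := by rw [hx, sub_mul]; abel
    rw [e1]
    calc _ ≤ ‖(e * p - p) * e‖ + ‖p * e - p‖ := norm_add_le _ _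
      _ ≤ ‖e * p - p‖ * ‖e‖ + ‖p * e - p‖ := by gcongr; exact norm_mul_le _ _
      _ ≤ 1 / 100 * 1 + 1 / 100 := by gcongr
      _ = 2 / 100 := by norm_num
  have hxn : ‖x‖ ≤ 1 := by
    calc ‖x‖ ≤ ‖e‖ * ‖p‖ * ‖e‖ := norm_mul₃_le
      _ ≤ 1 * 1 * 1 := by gcongr
      _ = 1 := by norm_num
  have hxx : ‖x * x - x‖ ≤ 6 / 100 := by
    have e1 : x * x - x = x * (x - p) + (x - p) * p - (x - p) := by
      rw [mul_sub, sub_mul, hpp]; abel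
    rw [e1]
    calc _ ≤ ‖x * (x - p)‖ + ‖(x - p) * p‖ + ‖x - p‖ :=
          (norm_sub_le _ _).trans (by gcongr; exact norm_add_le _ _)
      _ ≤ ‖x‖ * ‖x - p‖ + ‖x - p‖ * ‖p‖ + ‖x - p‖ := by gcongr <;> exact norm_mul_le _ _
      _ ≤ 1 * (2 / 100) + 2 / 100 * 1 + 2 / 100 := by gcongr
      _ = 6 / 100 := by norm_num
  have hxsa : IsSelfAdjoint x := by
    rw [IsSelfAdjoint, hx]; simp [hes, hps, mul_assoc]
  obtain ⟨r, hr, hrx, y, hy⟩ := exists_projection_near (x := (x : A⁺¹)) (hxsa.inr ℂ)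
    (δ := 6 / 100) (by norm_num)
    (by rw [← Unitization.inr_mul, ← Unitization.inr_sub ℂ, Unitization.norm_inr]; exact hxx)
  obtain ⟨r₀, rfl⟩ := exists_inr_eq (x := r) (by rw [hy]; simp)
  refine ⟨r₀, Unitization.isStarProjection_inr_iff.1 hr, ?_, ?_⟩
  · apply Unitization.inr_injective (R := ℂ)
    rw [Unitization.inr_mul, hy, ← mul_assoc, ← Unitization.inr_mul, hx, ← mul_assoc, ← mul_assoc,
      he.isIdempotentElem.eq]
  · have e1 : (r₀ : A⁺¹) - p = (r₀ - x) + ((x - p : A) : A⁺¹) := by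
      rw [Unitization.inr_sub]; abel
    rw [e1]
    calc _ ≤ ‖(r₀ : A⁺¹) - x‖ + ‖((x - p : A) : A⁺¹)‖ := norm_add_le _ _
      _ ≤ 2 * (6 / 100) + 2 / 100 := by rw [Unitization.norm_inr]; gcongr
      _ < 1 := by norm_num

/-- Equivalent projections of `A` that are not the unit have equivalent complements. -/
theorem ProjEquiv.one_sub (hA : IsPurelyInfiniteSimple A) {p q : A}
    (hp : IsStarProjection p) (hq : IsStarProjection q) (hpu : ¬ ∀ a, p * a = a)
    (hqu : ¬ ∀ a, q * a = a) (h : ProjEquiv p q) :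
    ProjEquiv (1 - (p : A⁺¹)) (1 - (q : A⁺¹)) := by
  by_cases hunit : ∃ e : A, IsStarProjection e ∧ ∀ a, e * a = a
  · obtain ⟨e, he, hu⟩ := hunit
    exact ProjEquiv.one_sub_of_le hA hp hq he (hu p) (hu q) (fun h => hpu (h ▸ hu))
      (fun h => hqu (h ▸ hu)) h
  · obtain ⟨e, he, hap⟩ := exists_projection_near_unit hA (Finset.univ : Finset Bool)
      (fun b => if b then p else q) (ε := 1 / 100) (by norm_num)
    obtain ⟨p', hp', hep, hpp⟩ := exists_subprojection_near he hp
      (by simpa using hap true (Finset.mem_univ _))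
    obtain ⟨q', hq', heq, hqq⟩ := exists_subprojection_near he hq
      (by simpa using hap false (Finset.mem_univ _))
    have hee := he.isIdempotentElem.eq
    obtain ⟨a, ha⟩ : ∃ a, e * a ≠ a := by
      by_contra! hcon
      exact hunit ⟨e, he, hcon⟩
    have hz : (a - e * a) * star (a - e * a) ≠ 0 := fun h0 =>
      ha (sub_eq_zero.1 (eq_zero_of_mul_star_self h0)).symm
    have hez : e * ((a - e * a) * star (a - e * a)) = 0 := by
      rw [← mul_assoc, mul_sub, ← mul_assoc, hee]; simp
    have hze : ((a - e * a) * star (a - e * a)) * e = 0 := by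
      simpa [he.isSelfAdjoint.star_eq] using congrArg star hez
    -- `p'` or `q'` could be all of `e`. Enlarging `e` by an orthogonal `p₀`, possible as `e` is not
    -- a unit, makes both proper.
    obtain ⟨p₀, ⟨hp₀, v, hv1, hv2, hv3⟩, hep₀⟩ := exists_infinite_of_annihilated hA
      he.inr.isSelfAdjoint hz (by rw [← Unitization.inr_mul, hez]; simp)
      (by rw [← Unitization.inr_mul, hze]; simp)
    have hep₀' : e * p₀ = 0 := Unitization.inr_injective (R := ℂ) (by simpa using hep₀)
    have hp₀e : p₀ * e = 0 := by
      simpa [he.isSelfAdjoint.star_eq, hp₀.isSelfAdjoint.star_eq] using congrArg star hep₀'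
    have hp₀0 : p₀ ≠ 0 := by
      rintro rfl
      apply hv3
      rw [← hv2, zero_mul]
    have hne : ∀ r, e * r = r → r ≠ e + p₀ := by
      rintro r hr rfl
      apply hp₀0
      rw [mul_add, hee, hep₀', add_zero] at hr
      simpa using hr.symm
    have hsub : ∀ r, e * r = r → (e + p₀) * r = r := by
      intro r hr
      rw [add_mul, hr]
      conv_lhs => rw [← hr, ← mul_assoc p₀, hp₀e]
      rw [hr]; simp
    have near : ∀ {r s : A}, IsStarProjection r → IsStarProjection s → ‖(r : A⁺¹) - s‖ < 1 →
        ProjEquiv (1 - (r : A⁺¹)) (1 - (s : A⁺¹)) := by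
      intro r s hr hs hrs
      refine ProjEquiv.of_norm_sub_lt_one hr.inr.one_sub hs.inr.one_sub ?_
      rwa [sub_sub_sub_cancel_left, norm_sub_rev]
    have hp'p := ProjEquiv.of_inr hp' (ProjEquiv.of_norm_sub_lt_one hp'.inr hp.inr hpp)
    have hq'q := ProjEquiv.of_inr hq' (ProjEquiv.of_norm_sub_lt_one hq'.inr hq.inr hqq)
    have h1 := ProjEquiv.one_sub_of_le hA hp' hq' (he.add hp₀ hep₀') (hsub p' hep) (hsub q' heq)
      (hne p' hep) (hne q' heq) ((hp'p.trans hp' hq h).trans hp' hq' hq'q.symm)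
    exact ((near hp' hp hpp).symm.trans hp.inr.one_sub hq'.inr.one_sub h1).trans
      hp.inr.one_sub hq.inr.one_sub (near hq' hq hqq)

theorem exists_unitary_conj (hA : IsPurelyInfiniteSimple A) {p₁ p₂ q₁ q₂ : A}
    (hp₁ : IsStarProjection p₁) (hp₂ : IsStarProjection p₂) (hq₁ : IsStarProjection q₁)
    (hq₂ : IsStarProjection q₂) (hp : p₁ * p₂ = 0) (hq : q₁ * q₂ = 0)
    (hpu : ¬ ∀ a, (p₁ + p₂) * a = a) (hqu : ¬ ∀ a, (q₁ + q₂) * a = a)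
    (h₁ : ProjEquiv p₁ q₁) (h₂ : ProjEquiv p₂ q₂) :
    ∃ u ∈ unitary A⁺¹, u * (p₁ : A⁺¹) * star u = q₁ ∧ u * (p₂ : A⁺¹) * star u = q₂ := by
  have hp₁₂ := hp₁.add hp₂ hp
  have hq₁₂ := hq₁.add hq₂ hq
  have h₃ : ProjEquiv (p₁ + p₂) (q₁ + q₂) := h₁.add hp₁ hq₁ hp₂ hq₂ hp hq h₂
  exact exists_unitary_of_projEquiv hp₁.inr hp₂.inr hp₁₂.inr.one_sub hq₁.inr hq₂.inr
    hq₁₂.inr.one_sub (by simp) (by simp) (by rw [← Unitization.inr_mul, hp]; simp)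
    (by rw [← Unitization.inr_mul, hq]; simp) h₁.symm.inr h₂.symm.inr
    (ProjEquiv.one_sub hA hp₁₂ hq₁₂ hpu hqu h₃).symm

end Unitary

/-! ### Inner automorphisms given by unitaries of the unitization -/

section Inner

variable {A : Type*} [NonUnitalCStarAlgebra A]

/-- Conjugation of `A` by an element of its unitization. -/
def conj (u : A⁺¹) (x : A) : A := (u * (x : A⁺¹) * star u).snd

theorem inr_conj (u : A⁺¹) (x : A) : ((conj u x : A) : A⁺¹) = u * (x : A⁺¹) * star u :=
  Unitization.ext (by simp) (by simp [conj])

theorem conj_conj (u w : A⁺¹) (x : A) : conj u (conj w x) = conj (u * w) x := by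
  apply Unitization.inr_injective (R := ℂ)
  simp only [inr_conj, star_mul, mul_assoc]

theorem conj_one (x : A) : conj 1 x = x := by
  apply Unitization.inr_injective (R := ℂ)
  simp [inr_conj]

/-- The automorphism `Ad(u)` of `A`. -/
def innerAut (u : unitary A⁺¹) : A ≃⋆ₐ[ℂ] A where
  toFun := conj u
  invFun := conj (star u : unitary A⁺¹)
  left_inv x := by rw [conj_conj, Unitary.coe_star, Unitary.star_mul_self_of_mem u.2, conj_one]
  right_inv x := by rw [conj_conj, Unitary.coe_star, Unitary.mul_star_self_of_mem u.2, conj_one]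
  map_mul' x y := by
    apply Unitization.inr_injective (R := ℂ)
    simp only [inr_conj, Unitization.inr_mul]
    calc _ = (u : A⁺¹) * x * (star (u : A⁺¹) * u) * y * star (u : A⁺¹) := by
          rw [Unitary.star_mul_self_of_mem u.2]; simp only [mul_assoc, one_mul]
      _ = _ := by simp only [mul_assoc]
  map_add' x y := by
    apply Unitization.inr_injective (R := ℂ)
    simp only [inr_conj, Unitization.inr_add, mul_add, add_mul]
  map_star' x := by
    apply Unitization.inr_injective (R := ℂ)
    simp only [inr_conj, Unitization.inr_star, star_mul, star_star, mul_assoc]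
  map_smul' c x := by
    apply Unitization.inr_injective (R := ℂ)
    simp only [inr_conj, Unitization.inr_smul, mul_smul_comm, smul_mul_assoc]

theorem innerAut_apply (u : unitary A⁺¹) (x : A) : innerAut u x = conj (u : A⁺¹) x := rfl

/-- The homomorphism `u ↦ Ad(u)`. -/
def innerHom (A : Type*) [NonUnitalCStarAlgebra A] : unitary A⁺¹ →* (A ≃⋆ₐ[ℂ] A) where
  toFun := innerAut
  map_one' := StarAlgEquiv.ext fun x => conj_one x
  map_mul' u w := StarAlgEquiv.ext fun x => (conj_conj (u : A⁺¹) w x).symm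

/-- Conjugating `Ad(u)` by `γ` gives `Ad` of the image of `u` under the unitization of `γ`. -/
instance innerHom_range_normal : (innerHom A).range.Normal where
  conj_mem := by
    rintro _ ⟨u, rfl⟩ γ
    have hu := Unitary.mem_iff.1 u.2
    refine ⟨⟨Unitization.starMap (γ : A →⋆ₙₐ[ℂ] A) u, Unitary.mem_iff.2 ?_⟩, ?_⟩
    · rw [← map_star, ← map_mul, ← map_mul, hu.1, hu.2, map_one]
      exact ⟨rfl, rfl⟩
    · refine StarAlgEquiv.ext fun x => Unitization.inr_injective (R := ℂ) ?_
      change ((conj (Unitization.starMap (γ : A →⋆ₙₐ[ℂ] A) u) x : A) : A⁺¹) =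
        ((γ (conj (u : A⁺¹) (γ⁻¹ x)) : A) : A⁺¹)
      have h1 : ∀ z : A, ((γ z : A) : A⁺¹) = Unitization.starMap (γ : A →⋆ₙₐ[ℂ] A) (z : A⁺¹) :=
        fun z => by simp
      have h2 : γ (γ⁻¹ x) = x := γ.apply_symm_apply x
      rw [h1, inr_conj, inr_conj, map_mul, map_mul, ← h1, h2, map_star]

/-- The inclusion of A in its multiplier algebra extends to a unital map on A⁺, which carries `u` to
the required multiplier. -/
theorem isInner_innerAut (u : unitary A⁺¹) : IsInner (innerAut u) := by
  let Θ : A⁺¹ →⋆ₐ[ℂ] 𝓜(ℂ, A) := Unitization.starLift (DoubleCentralizer.coeHom)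
  have hΘ : ∀ a : A, Θ (a : A⁺¹) = (a : 𝓜(ℂ, A)) := fun a =>
    DFunLike.congr_fun (Unitization.starLift.symm_apply_apply
      (DoubleCentralizer.coeHom : A →⋆ₙₐ[ℂ] 𝓜(ℂ, A))) a
  have hu := Unitary.mem_iff.1 u.2
  refine ⟨Θ u, Unitary.mem_iff.2 ?_, fun x => ?_⟩
  · rw [← map_star, ← map_mul, ← map_mul, hu.1, hu.2, map_one]
    exact ⟨rfl, rfl⟩
  · rw [innerAut_apply, ← hΘ, inr_conj, map_mul, map_mul, hΘ, map_star]

theorem starMap_innerAut (u : unitary A⁺¹) (x : A⁺¹) :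
    Unitization.starMap (innerAut u : A →⋆ₙₐ[ℂ] A) x = u * x * star (u : A⁺¹) := by
  induction x using Unitization.ind with
  | inl_add_inr c a =>
    rw [map_add, mul_add, add_mul, Unitization.starMap_inr, Unitization.starMap_inl]
    congr 1
    · rw [← Unitization.algebraMap_eq_inl, ← Algebra.commutes, mul_assoc,
        Unitary.mul_star_self_of_mem u.2, mul_one]
    · exact inr_conj _ _

/-- The image of a projection matrix `r` is its conjugate by the diagonal matrix of `u`, and
`diag(u) r` is the partial isometry between them. -/
theorem V_map_starMap_innerAut (u : unitary A⁺¹) (x : V A⁺¹) :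
    V.map (Unitization.starMap (innerAut u : A →⋆ₙₐ[ℂ] A)) x = x := by
  obtain ⟨r⟩ := x
  have h1 := r.isProj.isIdempotentElem.eq
  have h2 : r.matᴴ = r.mat := r.isProj.isSelfAdjoint.star_eq
  have h3 : MvN (r.mat.map (Unitization.starMap (innerAut u : A →⋆ₙₐ[ℂ] A))) r.mat := by
    refine ⟨Matrix.diagonal (fun _ => (u : A⁺¹)) * r.mat, ?_, ?_⟩
    · rw [Matrix.conjTranspose_mul, h2, Matrix.mul_assoc, ← Matrix.mul_assoc r.mat, h1,
        Matrix.diagonal_conjTranspose]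
      ext1 i j
      rw [Matrix.diagonal_mul, Matrix.mul_diagonal, Matrix.map_apply, starMap_innerAut, mul_assoc]
      rfl
    · rw [Matrix.conjTranspose_mul, h2, Matrix.mul_assoc, ← Matrix.mul_assoc (Matrix.diagonal _)ᴴ,
        Matrix.diagonal_conjTranspose, Matrix.diagonal_mul_diagonal]
      have h4 : (Matrix.diagonal fun i : Fin r.size => (star fun _ : Fin r.size => (u : A⁺¹)) i *
          (u : A⁺¹)) = 1 := by
        rw [← Matrix.diagonal_one]
        congr 1
        funext i
        exact Unitary.star_mul_self_of_mem u.2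
      rw [h4, Matrix.one_mul, h1]
  exact Quotient.sound (s := projSetoid A⁺¹) h3

theorem K0_map_innerAut (u : unitary A⁺¹) :
    K0.map (innerAut u : A →⋆ₙₐ[ℂ] A) = AddMonoidHom.id (K0 A) := by
  have h : K0Unital.map (Unitization.starMap (innerAut u : A →⋆ₙₐ[ℂ] A)) =
      AddMonoidHom.id (K0Unital A⁺¹) := by
    apply Algebra.GrothendieckAddGroup.lift.symm.injective
    ext y
    change K0Unital.map _ (Algebra.GrothendieckAddGroup.of y) = Algebra.GrothendieckAddGroup.of y
    rw [K0Unital.map_of, V_map_starMap_innerAut]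
  ext x
  exact DFunLike.congr_fun h (x : K0Unital A⁺¹)

theorem K0_map_mul (φ ψ : A ≃⋆ₐ[ℂ] A) :
    K0.map ((φ * ψ : A ≃⋆ₐ[ℂ] A) : A →⋆ₙₐ[ℂ] A) =
      (K0.map (φ : A →⋆ₙₐ[ℂ] A)).comp (K0.map (ψ : A →⋆ₙₐ[ℂ] A)) := by
  ext x
  change K0Unital.map _ (x : K0Unital A⁺¹) = K0Unital.map _ (K0Unital.map _ (x : K0Unital A⁺¹))
  rw [K0Unital.map_comp, ← Unitization.starMap_comp]
  rfl

end Inner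

/-! ### Construction of the perturbation -/

section Construction

variable {A : Type*} [NonUnitalCStarAlgebra A]

theorem not_unit_of_coe_ne_one {p : A} (hp : IsStarProjection p) (h : (p : 𝓜(ℂ, A)) ≠ 1) :
    ¬ ∀ a, p * a = a := by
  intro hu
  apply h
  have hu' : ∀ a, a * p = a := fun a => by
    simpa [hp.isSelfAdjoint.star_eq] using congrArg star (hu (star a))
  ext y
  · simpa using hu y
  · simpa using hu' y

theorem exists_conj_pair (hA : IsPurelyInfiniteSimple A) {γ : A ≃⋆ₐ[ℂ] A}
    (hγ : K0.map (γ : A →⋆ₙₐ[ℂ] A) = AddMonoidHom.id (K0 A)) {x₁ x₂ : K0 A} {d d' : A × A}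
    (hd : d ∈ projPairs A x₁ x₂) (hd' : d' ∈ projPairs A x₁ x₂) :
    ∃ u : unitary A⁺¹, innerAut u (γ d.1) = d'.1 ∧ innerAut u (γ d.2) = d'.2 := by
  obtain ⟨a1, a2, ⟨a3, a4⟩, ⟨a5, a6⟩, a7, a8⟩ := projPairs_mem_map γ hγ hd
  obtain ⟨b1, b2, ⟨b3, b4⟩, ⟨b5, b6⟩, b7, b8⟩ := hd'
  obtain ⟨u, hu, h1, h2⟩ := exists_unitary_conj hA a3 a5 b3 b5 a7 b7
    (not_unit_of_coe_ne_one (a3.add a5 a7) a8) (not_unit_of_coe_ne_one (b3.add b5 b7) b8)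
    (ProjEquiv.of_cls_eq hA a3 a1 b3 b1 (a4.trans b4.symm))
    (ProjEquiv.of_cls_eq hA a5 a2 b5 b2 (a6.trans b6.symm))
  exact ⟨⟨u, hu⟩, Unitization.inr_injective (R := ℂ) ((inr_conj _ _).trans h1),
    Unitization.inr_injective (R := ℂ) ((inr_conj _ _).trans h2)⟩

/-- The cases where the equivalence results fail, `p = 0` and `p` the unit, are fixed by `γ`
already. Otherwise the result for pairs is used with second projections 0. -/
theorem exists_conj_fixed (hA : IsPurelyInfiniteSimple A) {γ : A ≃⋆ₐ[ℂ] A}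
    (hγ : K0.map (γ : A →⋆ₙₐ[ℂ] A) = AddMonoidHom.id (K0 A)) {p : A} (hp : IsStarProjection p) :
    ∃ u : unitary A⁺¹, innerAut u (γ p) = p := by
  by_cases hfix : γ p = p
  · exact ⟨1, by rw [hfix]; exact conj_one p⟩
  have hγp : IsStarProjection (γ p) := hp.map γ
  have hp0 : p ≠ 0 := by rintro rfl; exact hfix (map_zero γ)
  have hγp0 : γ p ≠ 0 := by simpa using hp0
  have hpu : ¬ ∀ a, p * a = a := by
    intro hu
    apply hfix
    have h1 : γ p * p = p := by
      obtain ⟨b, rfl⟩ : ∃ b, γ b = p := ⟨γ.symm p, γ.apply_symm_apply p⟩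
      rw [← map_mul, hu]
    have h2 : p * γ p = p := by
      simpa [hp.isSelfAdjoint.star_eq, hγp.isSelfAdjoint.star_eq] using congrArg star h1
    exact (hu (γ p)).symm.trans h2
  have hγpu : ¬ ∀ a, γ p * a = a := by
    intro hu
    exact hpu fun a => γ.injective (by rw [map_mul]; exact hu (γ a))
  have hcls : K0.cls (γ p) hγp = K0.cls p hp :=
    (K0.map_cls (γ : A →⋆ₙₐ[ℂ] A) p hp).symm.trans (by rw [hγ]; rfl)
  have hz := IsStarProjection.zero A
  obtain ⟨u, hu, h1, -⟩ := exists_unitary_conj hA hγp hz hp hz (mul_zero _) (mul_zero _)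
    (by simpa using hγpu) (by simpa using hpu)
    (ProjEquiv.of_cls_eq hA hγp hγp0 hp hp0 hcls) (ProjEquiv.refl hz)
  exact ⟨⟨u, hu⟩, Unitization.inr_injective (R := ℂ) ((inr_conj _ _).trans h1)⟩

/-- Perturbing the generators by unitaries of the unitization gives an inner perturbation with the
same action on `K₀`. -/
theorem exists_perturbation (α : FreeGroup ℕ →* (A ≃⋆ₐ[ℂ] A)) (hα : ActsTriviallyOnK0 α)
    (u : ℕ → unitary A⁺¹) :
    ∃ β : FreeGroup ℕ →* (A ≃⋆ₐ[ℂ] A), IsInnerPerturbation α β ∧ ActsTriviallyOnK0 β ∧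
      ∀ n x, β (FreeGroup.of n) x = innerAut (u n) (α (FreeGroup.of n) x) := by
  let β : FreeGroup ℕ →* (A ≃⋆ₐ[ℂ] A) :=
    FreeGroup.lift fun n => innerAut (u n) * α (FreeGroup.of n)
  have hβ : ∀ n, β (FreeGroup.of n) = innerAut (u n) * α (FreeGroup.of n) := fun n =>
    FreeGroup.lift_apply_of
  -- Modulo the normal subgroup of all `Ad(u)`, the two actions agree on generators, hence on the
  -- whole group.
  have hq : (QuotientGroup.mk' (innerHom A).range).comp β =
      (QuotientGroup.mk' (innerHom A).range).comp α := by
    refine FreeGroup.ext_hom _ _ fun n => ?_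
    have h1 : (QuotientGroup.mk' (innerHom A).range) (innerAut (u n)) = 1 :=
      (QuotientGroup.eq_one_iff _).2 ⟨u n, rfl⟩
    rw [MonoidHom.comp_apply, hβ, map_mul, h1, one_mul, MonoidHom.comp_apply]
  have hmem : ∀ s, ∃ w, innerAut w = β s * (α s)⁻¹ := by
    intro s
    have h1 := DFunLike.congr_fun hq s
    have h2 : QuotientGroup.mk' (innerHom A).range (β s * (α s)⁻¹) = 1 := by
      rw [map_mul, map_inv]
      exact mul_inv_eq_one.2 h1
    exact (QuotientGroup.eq_one_iff _).1 h2
  refine ⟨β, fun s => ?_, fun s => ?_, fun n x => by rw [hβ]; rfl⟩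
  · obtain ⟨w, hw⟩ := hmem s
    rw [← hw]
    exact isInner_innerAut w
  · obtain ⟨w, hw⟩ := hmem s
    have h1 : β s = innerAut w * α s := by rw [hw]; group
    rw [h1, K0_map_mul, K0_map_innerAut, hα s]
    rfl

/-- Projections at distance less than 1 are equivalent, so K₀ classes are locally constant. Hence a
dense subset of the union of all P(A; x₁, x₂) is dense in each of them. -/
theorem mem_projPairs_of_near {x₁ x₂ y₁ y₂ : K0 A} {d c : A × A} (hd : d ∈ projPairs A x₁ x₂)
    (hc : c ∈ projPairs A y₁ y₂) (h : dist d c < 1) : c ∈ projPairs A x₁ x₂ := by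
  obtain ⟨-, -, ⟨a3, rfl⟩, ⟨a5, rfl⟩, -, -⟩ := hd
  obtain ⟨b1, b2, ⟨b3, -⟩, ⟨b5, -⟩, b7, b8⟩ := hc
  have key : ∀ {p q : A} (hp : IsStarProjection p) (hq : IsStarProjection q), dist p q < 1 →
      K0.cls q hq = K0.cls p hp := by
    intro p q hp hq hpq
    refine cls_eq_of_projEquiv (ProjEquiv.of_inr hp (ProjEquiv.of_norm_sub_lt_one hp.inr hq.inr
      ?_)).symm
    rwa [← Unitization.inr_sub ℂ, Unitization.norm_inr, ← dist_eq_norm]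
  rw [Prod.dist_eq, max_lt_iff] at h
  exact ⟨b1, b2, ⟨b3, key a3 b3 h.1⟩, ⟨b5, key a5 b5 h.2⟩, b7, b8⟩

theorem dist_starAlgEquiv (φ : A ≃⋆ₐ[ℂ] A) (x y : A) : dist (φ x) (φ y) = dist x y := by
  rw [dist_eq_norm, dist_eq_norm, ← map_sub]
  exact NonUnitalStarAlgHom.norm_map φ φ.injective _

end Construction

end CStarPert

end

/-! ### The main theorem: one task for each generator -/

open CStarPert in
theorem mainTheorem11 {A : Type*} [NonUnitalCStarAlgebra A] [TopologicalSpace.SeparableSpace A]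
    (hA : IsPurelyInfiniteSimple A) (α : FreeGroup ℕ →* (A ≃⋆ₐ[ℂ] A))
    (hα : ActsTriviallyOnK0 α) :
    ∃ β : FreeGroup ℕ →* (A ≃⋆ₐ[ℂ] A), IsInnerPerturbation α β ∧
      (∃ hβ : ActsTriviallyOnK0 β, ∀ x₁ x₂ : K0 A,
        letI := projPairsAction β hβ x₁ x₂
        MulAction.IsMinimal (FreeGroup ℕ) (projPairs A x₁ x₂)) ∧
      {p : A | IsStarProjection p} ⊆ closure (twoFixedProjections β) := by
  obtain ⟨D, hDZ, hDc, hD⟩ := (TopologicalSpace.IsSeparable.of_separableSpace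
    {d : A × A | ∃ x₁ x₂, d ∈ projPairs A x₁ x₂}).exists_countable_dense_subset
  obtain ⟨E, hEP, hEc, hE⟩ := (TopologicalSpace.IsSeparable.of_separableSpace
    {p : A | IsStarProjection p}).exists_countable_dense_subset
  -- The `Bool` lists every `p` of `E` twice; the two indices are distinct because their tasks are.
  let T := {c : D × D // ∃ x₁ x₂, c.1.1 ∈ projPairs A x₁ x₂ ∧ c.2.1 ∈ projPairs A x₁ x₂} ⊕
    (E × Bool)
  have := hDc.to_subtype
  have := hEc.to_subtype
  have : Nonempty T := by
    obtain ⟨p, hp⟩ := closure_nonempty_iff.1 ⟨0, hE (IsStarProjection.zero A)⟩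
    exact ⟨Sum.inr (⟨p, hp⟩, true)⟩
  obtain ⟨task, htask⟩ := exists_surjective_nat T
  have step : ∀ n, ∃ u : unitary (Unitization ℂ A),
      (∀ c, task n = Sum.inl c →
        innerAut u (α (FreeGroup.of n) c.1.1.1.1) = c.1.2.1.1 ∧
          innerAut u (α (FreeGroup.of n) c.1.1.1.2) = c.1.2.1.2) ∧
      ∀ p b, task n = Sum.inr (p, b) → innerAut u (α (FreeGroup.of n) p.1) = p.1 := by
    intro n
    rcases task n with c | ⟨p, b⟩
    · obtain ⟨x₁, x₂, h1, h2⟩ := c.2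
      obtain ⟨u, hu⟩ := exists_conj_pair hA (hα (FreeGroup.of n)) h1 h2
      refine ⟨u, fun c' hc' => ?_, fun p b h => by simp at h⟩
      rw [← Sum.inl.inj hc']
      exact hu
    · obtain ⟨u, hu⟩ := exists_conj_fixed hA (hα (FreeGroup.of n)) (hEP p.2)
      refine ⟨u, fun c' hc' => by simp at hc', fun p' b' h => ?_⟩
      rw [← (Prod.mk.inj (Sum.inr.inj h)).1]
      exact hu
  choose u hu1 hu2 using step
  obtain ⟨β, hβ1, hβ2, hβ⟩ := exists_perturbation α hα u
  refine ⟨β, hβ1, ⟨hβ2, fun x₁ x₂ => ?_⟩, ?_⟩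
  · let _ := projPairsAction β hβ2 x₁ x₂
    refine ⟨fun d => Metric.dense_iff.2 fun d' ε hε => ?_⟩
    have near : ∀ z : projPairs A x₁ x₂, ∃ c ∈ D, dist z.1 c < ε / 2 ∧ c ∈ projPairs A x₁ x₂ := by
      intro z
      obtain ⟨c, hc, hzc⟩ := Metric.mem_closure_iff.1 (hD ⟨x₁, x₂, z.2⟩) (min (ε / 2) 1)
        (by positivity)
      obtain ⟨y₁, y₂, hcy⟩ := hDZ hc
      exact ⟨c, hc, hzc.trans_le (min_le_left _ _),
        mem_projPairs_of_near z.2 hcy (hzc.trans_le (min_le_right _ _))⟩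
    obtain ⟨c, hcD, hdc, hc⟩ := near d
    obtain ⟨c', hcD', hdc', hc'⟩ := near d'
    -- A single generator carries `c` exactly to `c'`, and being isometric it carries `d` to within
    -- ε of `d'`.
    obtain ⟨n, hn⟩ := htask (Sum.inl ⟨(⟨c, hcD⟩, ⟨c', hcD'⟩), x₁, x₂, hc, hc'⟩)
    obtain ⟨h1, h2⟩ := hu1 n _ hn
    rw [← hβ] at h1 h2
    refine ⟨FreeGroup.of n • d, ?_, MulAction.mem_orbit _ _⟩
    rw [Metric.mem_ball, Subtype.dist_eq]
    change dist (β (FreeGroup.of n) d.1.1, β (FreeGroup.of n) d.1.2) d'.1 < ε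
    have h3 : dist (β (FreeGroup.of n) d.1.1, β (FreeGroup.of n) d.1.2) c' = dist d.1 c := by
      have e : c' = (β (FreeGroup.of n) c.1, β (FreeGroup.of n) c.2) :=
        Prod.ext h1.symm h2.symm
      rw [e, Prod.dist_eq, Prod.dist_eq, dist_starAlgEquiv, dist_starAlgEquiv]
    calc _ ≤ _ := dist_triangle _ c' _
      _ < ε / 2 + ε / 2 := by rw [h3, dist_comm c']; exact add_lt_add hdc hdc'
      _ = ε := add_halves ε
  · refine hE.trans (closure_mono fun p hp => ⟨hEP hp, ?_⟩)
    obtain ⟨i, hi⟩ := htask (Sum.inr (⟨p, hp⟩, true))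
    obtain ⟨j, hj⟩ := htask (Sum.inr (⟨p, hp⟩, false))
    refine ⟨i, j, ?_, ?_, ?_⟩
    · rintro rfl
      rw [hi] at hj
      exact Bool.noConfusion (Prod.mk.inj (Sum.inr.inj hj)).2
    · rw [hβ]
      exact hu2 i _ _ hi
    · rw [hβ]
      exact hu2 j _ _ hj
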